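/- **Setting.** Let $m,u\ge 1$, $n=m+u$, and let $(x_1,y_1),\dots,(x_n,y_n)\in\mathcal X\times\mathcal Y$ be a full sample. Let $\mathcal F$ be a class of functions $f:\mathcal X\to\mathbb R$, let $\ell:\mathbb R\times\mathcal Y\to\mathbb R$ be a loss, and put $\ell_f(x,y)=\ell(f(x),y)$. For $h:\mathcal X\times\mathcal Y\to\mathbb R$ write $h(i)=h(x_i,y_i)$. Assume that $0\le \ell_f(i)\le L_0$ for all $f\in\mathcal F$, $i\le n$, where $L_0\ge 2\sqrt2$. Let $\mathbf d=(d_1,\dots,d_u)$ have independent coordinates with $d_i$ uniform on $\{i,\dots,n\}$. Start with the array $I=(1,\dots,n)$ and, for $i=1,\dots,u$, put $Z_{\mathbf d}(i)=I(d_i)$ and then swap the values of $I(i)$ and $I(d_i)$. The test indices are $Z_{\mathbf d}=\{Z_{\mathbf d}(1),\dots,Z_{\mathbf d}(u)\}$ (a uniformly random $u$-subset of $[n]$), and the training indices are $\overline{Z_{\mathbf d}}=[n]\setminus Z_{\mathbf d}$. Define $$\mathcal L_n(h)=\tfrac1n\sum_{i=1}^n h(i),\quad T_n(h)=\tfrac1n\sum_{i=1}^n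 h(i)^2,\quad \mathcal U_h=\tfrac1u\sum_{i\in Z_{\mathbf d}}h(i),\quad \mathcal L_h=\tfrac1m\sum_{i\in\overline{Z_{\mathbf d}}}h(i),$$ $$R^{+}_{u,\mathbf d}h=\mathcal U_h-\mathcal L_n(h),\quad R^{+}_{m,\mathbf d}h=\mathcal L_h-\mathcal L_n(h),\quad R^-_{u,\mathbf d}h=-R^+_{u,\mathbf d}h,\quad R^-_{m,\mathbf d}h=-R^+_{m,\mathbf d}h .$$ Let $R^+_{\min\{u,m\},\mathbf d}$ be $R^+_{u,\mathbf d}$ if $u\le m$, and $R^+_{m,\mathbf d}$ otherwise. For every $\mathbf d$ let $\hat f_{\mathbf d,m}\in\mathcal F$ minimize the training loss $\mathcal L_{\ell_f}$ over $f\in\mathcal F$, and let $\hat f_{\mathbf d,u}\in\mathcal F$ minimize the test loss $\mathcal U_{\ell_f}$ over $f\in\mathcal F$. The excess risk is $$\mathcal E(\hat f_{\mathbf d,m})=\mathcal U_{\ell_{\hat f_{\mathbf d,m}}}-\mathcal U_{\ell_{\hat f_{\mathbf d,u}}}.$$ **Main Assumption.** There is $f_n^*\in\mathcal F$ with $\mathcal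 L_n(\ell_{f_n^*})=\inf_{f\in\mathcal F}\mathcal L_n(\ell_f)$, and there is a constant $B\ge 0$ such that $T_n(h)\le B\,\mathcal L_n(h)$ for all $h\in\Delta^*_{\mathcal F}=\{\ell_f-\ell_{f_n^*}: f\in\mathcal F\}$. **Localized complexities.** Let $\Delta_{\mathcal F}=\{\ell_{f_1}-\ell_{f_2}:f_1,f_2\in\mathcal F\}$, and for $h\in\Delta_{\mathcal F}$ let $$\tilde T_n(h)=\inf_{f_1,f_2\in\mathcal F:\ \ell_{f_1}-\ell_{f_2}=h}\bigl(2B\mathcal L_n(\ell_{f_1}-\ell_{f_n^*})+2B\mathcal L_n(\ell_{f_2}-\ell_{f_n^*})\bigr).$$ A function $\psi:[0,\infty)\to[0,\infty)$ is sub-root if it is nondecreasing and $\psi(r)/\sqrt r$ is nonincreasing on $r>0$; its fixed point is the largest $r\ge0$ with $\psi(r)=r$ (the unique positive one unless $\psi\equiv0$). Let $\psi_u,\psi_m,\psi_{u,m}$ be sub-root functions with fixed points $r_u,r_m,r^*$ such that $$\psi_u(r)\ge\max\Bigl\{\mathbb E_{\mathbf d}\sup_{h\in\Delta_{\mathcal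 F},\,\tilde T_n(h)\le r}R^+_{u,\mathbf d}h,\ \mathbb E_{\mathbf d}\sup_{h\in\Delta_{\mathcal F},\,\tilde T_n(h)\le r}R^+_{u,\mathbf d}h^2\Bigr\}\quad\text{for all } r\ge r_u,$$ $$\psi_m(r)\ge\max\Bigl\{\mathbb E_{\mathbf d}\sup_{h\in\Delta_{\mathcal F},\,\tilde T_n(h)\le r}R^-_{m,\mathbf d}h,\ \mathbb E_{\mathbf d}\sup_{h\in\Delta_{\mathcal F},\,\tilde T_n(h)\le r}R^+_{m,\mathbf d}h^2\Bigr\}\quad\text{for all } r\ge r_m,$$ and, for all $r\ge r^*$, $\psi_{u,m}(r)$ is at least each of $$\mathbb E_{\mathbf d}\sup_{h}R^-_{u,\mathbf d}h,\qquad \mathbb E_{\mathbf d}\sup_{h}R^-_{m,\mathbf d}h,\qquad \mathbb E_{\mathbf d}\sup_{h}R^+_{\min\{u,m\},\mathbf d}h^2,$$ the suprema being over $h\in\Delta^*_{\mathcal F}$ with $B\mathcal L_n(h)\le r$. **Theorem.** There are positive constants $c_0$ depending only on $K$, $c_1$ depending only on $K$ and $L_0$, and $c_2$ depending only on $B$ and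 $L_0$, such that in the above setting, for every $K>1$ and every $x>0$, with probability at least $1-2e^{-x}$ over $\mathbf d$, $$\mathcal E(\hat f_{\mathbf d,m})\le c_0(r_u+r_m)+\frac{4Bc_2}{K}\,r^*+\frac{c_3x}{\min\{m,u\}},\qquad c_3=c_1+\frac{4Bc_2}{K}.$$ -/

import Mathlib

open MeasureTheory

noncomputable section

namespace Transductive

/-! ### The random split of the full sample -/

/-- The possible values of the random vector `d = (d₁, …, d_u)` for a full sample of size
`n = m + u`. Indices start at `0`, so the coordinate `d i` ranges over `{i, …, n - 1}`. -/
abbrev Draw (m u : ℕ) : Type :=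
  (i : Fin u) → {j : Fin (m + u) // (i : ℕ) ≤ (j : ℕ)}

/-- The law of `d`: independent coordinates, the `i`-th one uniform on `{i, …, n - 1}`. -/
def drawLaw (m u : ℕ) : Measure (Draw m u) :=
  Measure.pi fun _ => ProbabilityTheory.uniformOn Set.univ

/-- The array `I` of the RANDPERM algorithm after its first `k` steps, as a permutation
(position ↦ value): `I` starts as the identity, and step `i` swaps the values at the positions
`i` and `d i`. -/
def permState {m u : ℕ} (d : Draw m u) : ℕ → Equiv.Perm (Fin (m + u))
  | 0 => 1
  | k + 1 =>
    if hk : k < u then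
      permState d k * Equiv.swap ⟨k, lt_of_lt_of_le hk (Nat.le_add_left u m)⟩ (d ⟨k, hk⟩).1
    else permState d k

/-- The `i`-th output `Z_d(i) = I(d i)` of RANDPERM, read off just before the swap of step `i`. -/
def testIndex {m u : ℕ} (d : Draw m u) (i : Fin u) : Fin (m + u) :=
  permState d i (d i).1

/-- The indices of the `u` test points. -/
def testSet {m u : ℕ} (d : Draw m u) : Finset (Fin (m + u)) :=
  Finset.univ.image (testIndex d)

/-- The indices of the `m` training points. -/
def trainSet {m u : ℕ} (d : Draw m u) : Finset (Fin (m + u)) :=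
  (testSet d)ᶜ

/-! ### Averages of a function `h` on `X × Y` over the sample `z = ((xᵢ, yᵢ))ᵢ` -/

section Averages

variable {X Y : Type*} {m u : ℕ}

/-- The full-sample average `L_n(h)`. -/
def fullAvg (z : Fin (m + u) → X × Y) (h : X × Y → ℝ) : ℝ :=
  (∑ i, h (z i)) / ((m : ℝ) + (u : ℝ))

/-- The average square `T_n(h)`. -/
def avgSq (z : Fin (m + u) → X × Y) (h : X × Y → ℝ) : ℝ :=
  fullAvg z (h ^ 2)

/-- The average over the test set, `U_h(Z_d)`. -/
def testAvg (z : Fin (m + u) → X × Y) (d : Draw m u) (h : X × Y → ℝ) : ℝ :=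
  (∑ i ∈ testSet d, h (z i)) / (u : ℝ)

/-- The average over the training set. -/
def trainAvg (z : Fin (m + u) → X × Y) (d : Draw m u) (h : X × Y → ℝ) : ℝ :=
  (∑ i ∈ trainSet d, h (z i)) / (m : ℝ)

/-- `R⁺_{u,d} h`; the quantity `R⁻_{u,d} h` is its negative. -/
def testDev (z : Fin (m + u) → X × Y) (d : Draw m u) (h : X × Y → ℝ) : ℝ :=
  testAvg z d h - fullAvg z h

/-- `R⁺_{m,d} h`; the quantity `R⁻_{m,d} h` is its negative. -/
def trainDev (z : Fin (m + u) → X × Y) (d : Draw m u) (h : X × Y → ℝ) : ℝ :=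
  trainAvg z d h - fullAvg z h

/-- `R⁺_{min(u,m),d} h`. -/
def minDev (z : Fin (m + u) → X × Y) (d : Draw m u) (h : X × Y → ℝ) : ℝ :=
  if u ≤ m then testDev z d h else trainDev z d h

/-- `E_d [ sup_{h ∈ H} R d h ]`. -/
def expSup (H : Set (X × Y → ℝ)) (R : Draw m u → (X × Y → ℝ) → ℝ) : ℝ :=
  ∫ d, sSup (R d '' H) ∂(drawLaw m u)

end Averages

/-! ### Losses, classes of loss differences, and the main assumption -/

section Losses

variable {X Y : Type*} {m u : ℕ}

/-- The loss `ℓ_f(x, y) = ℓ(f(x), y)` of the predictor `f`. -/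
def lossOf (ℓ : ℝ → Y → ℝ) (f : X → ℝ) : X × Y → ℝ :=
  fun p => ℓ (f p.1) p.2

/-- `Δ_F = {ℓ_{f₁} - ℓ_{f₂} : f₁, f₂ ∈ F}`. -/
def diffClass (ℓ : ℝ → Y → ℝ) (F : Set (X → ℝ)) : Set (X × Y → ℝ) :=
  {h | ∃ f₁ ∈ F, ∃ f₂ ∈ F, h = lossOf ℓ f₁ - lossOf ℓ f₂}

/-- `Δ*_F = {ℓ_f - ℓ_{f*} : f ∈ F}`. -/
def starClass (ℓ : ℝ → Y → ℝ) (F : Set (X → ℝ)) (fstar : X → ℝ) : Set (X × Y → ℝ) :=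
  {h | ∃ f ∈ F, h = lossOf ℓ f - lossOf ℓ fstar}

/-- The main assumption, with the full-sample minimizer `fstar` and the constant `B`. -/
structure MainAssumption (z : Fin (m + u) → X × Y) (ℓ : ℝ → Y → ℝ) (F : Set (X → ℝ))
    (fstar : X → ℝ) (B : ℝ) : Prop where
  mem : fstar ∈ F
  isMin : ∀ f ∈ F, fullAvg z (lossOf ℓ fstar) ≤ fullAvg z (lossOf ℓ f)
  avgSq_le : ∀ h ∈ starClass ℓ F fstar, avgSq z h ≤ B * fullAvg z h

/-- The surrogate variance operator `T̃_n` on `Δ_F`: the infimum of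
`2B L_n(ℓ_{f₁} - ℓ_{f*}) + 2B L_n(ℓ_{f₂} - ℓ_{f*})` over all representations
`h = ℓ_{f₁} - ℓ_{f₂}`. -/
def surrogate (z : Fin (m + u) → X × Y) (ℓ : ℝ → Y → ℝ) (F : Set (X → ℝ)) (fstar : X → ℝ)
    (B : ℝ) (h : X × Y → ℝ) : ℝ :=
  sInf {t | ∃ f₁ ∈ F, ∃ f₂ ∈ F, lossOf ℓ f₁ - lossOf ℓ f₂ = h ∧
    t = 2 * B * fullAvg z (lossOf ℓ f₁ - lossOf ℓ fstar) +
        2 * B * fullAvg z (lossOf ℓ f₂ - lossOf ℓ fstar)}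

/-- The localized class `{h ∈ Δ_F : T̃_n(h) ≤ r}`. -/
def localDiff (z : Fin (m + u) → X × Y) (ℓ : ℝ → Y → ℝ) (F : Set (X → ℝ)) (fstar : X → ℝ)
    (B r : ℝ) : Set (X × Y → ℝ) :=
  {h ∈ diffClass ℓ F | surrogate z ℓ F fstar B h ≤ r}

/-- The localized class `{h ∈ Δ*_F : B L_n(h) ≤ r}`. -/
def localStar (z : Fin (m + u) → X × Y) (ℓ : ℝ → Y → ℝ) (F : Set (X → ℝ)) (fstar : X → ℝ)
    (B r : ℝ) : Set (X × Y → ℝ) :=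
  {h ∈ starClass ℓ F fstar | B * fullAvg z h ≤ r}

/-- `fhat` is an empirical minimizer: for every draw it minimizes the training loss over `F`. -/
def IsTrainMinimizer (z : Fin (m + u) → X × Y) (ℓ : ℝ → Y → ℝ) (F : Set (X → ℝ))
    (fhat : Draw m u → X → ℝ) : Prop :=
  ∀ d, fhat d ∈ F ∧ ∀ f ∈ F, trainAvg z d (lossOf ℓ (fhat d)) ≤ trainAvg z d (lossOf ℓ f)

/-- `fhat` is an oracle predictor: for every draw it minimizes the test loss over `F`. -/
def IsTestMinimizer (z : Fin (m + u) → X × Y) (ℓ : ℝ → Y → ℝ) (F : Set (X → ℝ))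
    (fhat : Draw m u → X → ℝ) : Prop :=
  ∀ d, fhat d ∈ F ∧ ∀ f ∈ F, testAvg z d (lossOf ℓ (fhat d)) ≤ testAvg z d (lossOf ℓ f)

/-- The excess risk of `fhatm` relative to the oracle predictor `fhatu`. -/
def excessRisk (z : Fin (m + u) → X × Y) (ℓ : ℝ → Y → ℝ) (fhatm fhatu : Draw m u → X → ℝ)
    (d : Draw m u) : ℝ :=
  testAvg z d (lossOf ℓ (fhatm d)) - testAvg z d (lossOf ℓ (fhatu d))

end Losses

/-! ### Sub-root functions -/

/-- Sub-root functions `[0, ∞) → [0, ∞)`; values at negative arguments are irrelevant. -/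
structure IsSubRoot (ψ : ℝ → ℝ) : Prop where
  nonneg : ∀ r, 0 ≤ r → 0 ≤ ψ r
  mono : MonotoneOn ψ (Set.Ici 0)
  anti : AntitoneOn (fun r => ψ r / Real.sqrt r) (Set.Ioi 0)

/-- `r` is the fixed point of the sub-root function `ψ`. A sub-root function that is not
identically `0` has exactly one positive fixed point, but `0` may solve `ψ r = r` as well; the
fixed point is the largest solution. -/
def IsFixedPointOf (ψ : ℝ → ℝ) (r : ℝ) : Prop :=
  IsGreatest {s : ℝ | 0 ≤ s ∧ ψ s = s} r

end Transductive

end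

/-! Write `h` for the difference of the losses of the training minimizer and the test minimizer. Its
training average is nonpositive, so the excess risk, which is the test average of `h`, is at most
`R⁺_u h + R⁻_m h`. It is therefore enough to control these two deviations uniformly over a small
class that contains `h`.

Localization. The training minimizer does no worse than `fstar` on the training set, so its
full-sample excess loss is at most its own `R⁻_m` deviation; the test minimizer likewise satisfies
this with `R⁻_u`. Peeling over geometric shells (`IsUniformSet.measureReal_peeling_le`) turns this
self-referential bound into `B L_n ≤ σ`, with `σ` a multiple of `rstar + x / min m u`. Then `h` has
surrogate variance at most `4σ`, hence also mean square at most `4σ`, which places it in a localized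
difference class.

Concentration. The engine is a tail bound for suprema over a uniformly random set of fixed size,
`orbitAvg_iSup_meanDev_tail_le`. It is first proved for Bernoulli subsets, whose independence
permits induction on the points: `bernAvg_exp_iSup_mul_le_one` bounds a variance-penalized
exponential moment of the supremum against the exponential moment of its negative, and Jensen's
inequality replaces the latter by the mean. Adjoining the squares to the class makes the random
variance self-bounding. The passage between Bernoulli sets and slices goes both ways
(`orbitAvg_exp_supDev_le` for exponential moments, `bernAvg_supDev_le` for means), by comparing
nested sets and averaging over a stabilizer in the symmetric group. Sets containing at least half of
the points are handled through their complements.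

Finally the sub-root property and the fixed point trade `48 ψ(r)` for `r / K` plus a multiple of the
fixed point (`IsSubRoot.const_mul_le`), and four exceptional events of probability at most `e^{-x} /
2` are combined. -/

namespace Transductive

open Finset

noncomputable section

/-! ### Averages over Bernoulli subsets -/

section Bernoulli

variable {α : Type*}

/-- The expectation of `F A`, where `A ⊆ s` contains each point of `s` independently with
probability `p`. -/
def bernAvg (p : ℝ) (s : Finset α) (F : Finset α → ℝ) : ℝ :=
  ∑ A ∈ s.powerset, p ^ #A * (1 - p) ^ (#s - #A) * F A

variable {p : ℝ} {s : Finset α}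

lemma bernAvg_empty (F : Finset α → ℝ) : bernAvg p ∅ F = F ∅ := by
  simp [bernAvg]

lemma bernAvg_insert [DecidableEq α] {a : α} (ha : a ∉ s) (F : Finset α → ℝ) :
    bernAvg p (insert a s) F =
      (1 - p) * bernAvg p s F + p * bernAvg p s (fun A => F (insert a A)) := by
  unfold bernAvg
  rw [sum_powerset_insert ha, mul_sum, mul_sum]
  congr 1
  · refine sum_congr rfl fun A hA => ?_
    have h : #A ≤ #s := card_le_card (mem_powerset.1 hA)
    rw [card_insert_of_notMem ha, Nat.succ_sub h, pow_succ]
    ring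
  · refine sum_congr rfl fun A hA => ?_
    rw [card_insert_of_notMem ha, card_insert_of_notMem fun h => ha (mem_powerset.1 hA h),
      Nat.succ_sub_succ, pow_succ]
    ring

lemma bernAvg_add (F G : Finset α → ℝ) :
    bernAvg p s (fun A => F A + G A) = bernAvg p s F + bernAvg p s G := by
  simp [bernAvg, mul_add, sum_add_distrib]

lemma bernAvg_const_mul (c : ℝ) (F : Finset α → ℝ) :
    bernAvg p s (fun A => c * F A) = c * bernAvg p s F := by
  simp only [bernAvg, mul_sum]
  exact sum_congr rfl fun A _ => by ring

lemma bernAvg_one : bernAvg p s (fun _ => 1) = 1 := by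
  simp [bernAvg, sum_pow_mul_eq_add_pow]

lemma bernAvg_const (c : ℝ) : bernAvg p s (fun _ => c) = c := by
  simpa [bernAvg_one] using bernAvg_const_mul (p := p) (s := s) c (fun _ => 1)

lemma bernAvg_mono (hp0 : 0 ≤ p) (hp1 : p ≤ 1) {F G : Finset α → ℝ} (h : ∀ A ⊆ s, F A ≤ G A) :
    bernAvg p s F ≤ bernAvg p s G := by
  refine sum_le_sum fun A hA => mul_le_mul_of_nonneg_left (h A (mem_powerset.1 hA)) ?_
  have : 0 ≤ 1 - p := by linarith
  positivity

lemma bernAvg_congr {F G : Finset α → ℝ} (h : ∀ A ⊆ s, F A = G A) :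
    bernAvg p s F = bernAvg p s G :=
  sum_congr rfl fun A hA => by rw [h A (mem_powerset.1 hA)]

lemma bernAvg_exp_pos (hp0 : 0 ≤ p) (hp1 : p ≤ 1) (F : Finset α → ℝ) :
    0 < bernAvg p s (fun A => Real.exp (F A)) := by
  classical
  induction s using Finset.induction_on generalizing F with
  | empty => simpa [bernAvg_empty] using Real.exp_pos _
  | insert a s ha ih =>
    rw [bernAvg_insert ha]
    have h1 := ih F
    have h2 := ih (fun A => F (insert a A))
    rcases hp0.eq_or_lt with h | h
    · subst h; simpa using h1
    · have : 0 ≤ 1 - p := by linarith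
      positivity

/-- Jensen's inequality for the exponential function. -/
lemma exp_bernAvg_le (hp0 : 0 ≤ p) (hp1 : p ≤ 1) (F : Finset α → ℝ) :
    Real.exp (bernAvg p s F) ≤ bernAvg p s (fun A => Real.exp (F A)) := by
  set a := bernAvg p s F with ha
  have h : bernAvg p s (fun A => Real.exp a * (F A + (1 - a))) ≤
      bernAvg p s (fun A => Real.exp (F A)) := by
    -- The tangent line of `exp` at the mean `a` lies below `exp`; averaging it gives exactly `exp
    -- a`.
    refine bernAvg_mono hp0 hp1 fun A _ => ?_
    have h1 := Real.add_one_le_exp (F A - a)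
    have h2 : Real.exp (F A) = Real.exp a * Real.exp (F A - a) := by
      rw [← Real.exp_add]; congr 1; ring
    rw [h2]
    exact mul_le_mul_of_nonneg_left (by linarith) (Real.exp_pos a).le
  rw [bernAvg_const_mul, bernAvg_add, bernAvg_const, ← ha] at h
  linarith

/-- Hölder's inequality for exponentials. -/
lemma bernAvg_exp_convexComb_le (hp0 : 0 ≤ p) (hp1 : p ≤ 1) {F G : Finset α → ℝ} {a b t : ℝ}
    (ht0 : 0 ≤ t) (ht1 : t ≤ 1) (hF : bernAvg p s (fun A => Real.exp (F A)) ≤ Real.exp a)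
    (hG : bernAvg p s (fun A => Real.exp (G A)) ≤ Real.exp b) :
    bernAvg p s (fun A => Real.exp ((1 - t) * F A + t * G A)) ≤
      Real.exp ((1 - t) * a + t * b) := by
  have h : bernAvg p s (fun A => Real.exp ((1 - t) * F A + t * G A)) ≤
      bernAvg p s (fun A => Real.exp ((1 - t) * a + t * b) *
        ((1 - t) * Real.exp (-a) * Real.exp (F A) + t * Real.exp (-b) * Real.exp (G A))) := by
    refine bernAvg_mono hp0 hp1 fun A _ => ?_
    have h1 := convexOn_exp.2 (Set.mem_univ (F A - a)) (Set.mem_univ (G A - b))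
      (sub_nonneg.2 ht1) ht0 (by ring)
    simp only [smul_eq_mul] at h1
    have h2 : Real.exp ((1 - t) * F A + t * G A) = Real.exp ((1 - t) * a + t * b) *
        Real.exp ((1 - t) * (F A - a) + t * (G A - b)) := by
      rw [← Real.exp_add]; congr 1; ring
    rw [h2]
    refine mul_le_mul_of_nonneg_left (h1.trans_eq ?_) (Real.exp_pos _).le
    rw [mul_assoc, mul_assoc, ← Real.exp_add, ← Real.exp_add]
    ring_nf
  refine h.trans ?_
  rw [bernAvg_const_mul, bernAvg_add, bernAvg_const_mul, bernAvg_const_mul]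
  refine mul_le_of_le_one_right (Real.exp_pos _).le ?_
  have h3 : ∀ c, Real.exp (-c) * Real.exp c = 1 := fun c => by rw [← Real.exp_add]; simp
  have h4 := mul_le_mul_of_nonneg_left hF (mul_nonneg (sub_nonneg.2 ht1) (Real.exp_pos (-a)).le)
  have h5 := mul_le_mul_of_nonneg_left hG (mul_nonneg ht0 (Real.exp_pos (-b)).le)
  rw [mul_assoc (1 - t) (Real.exp (-a)) (Real.exp a), h3] at h4
  rw [mul_assoc t (Real.exp (-b)) (Real.exp b), h3] at h5
  linarith

lemma bernAvg_card : bernAvg p s (fun A => (#A : ℝ)) = p * #s := by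
  classical
  induction s using Finset.induction_on with
  | empty => simp [bernAvg_empty]
  | insert a s ha ih =>
    rw [bernAvg_insert ha, ih, bernAvg_congr (G := fun A => (#A : ℝ) + 1), bernAvg_add, ih,
      bernAvg_const, card_insert_of_notMem ha]
    · push_cast; ring
    · intro A hA
      rw [card_insert_of_notMem fun h => ha (hA h)]
      push_cast; rfl

lemma bernAvg_card_sub_sq :
    bernAvg p s (fun A => ((#A : ℝ) - p * #s) ^ 2) = p * (1 - p) * #s := by
  suffices h : bernAvg p s (fun A => (#A : ℝ) ^ 2) = p * (1 - p) * #s + (p * #s) ^ 2 by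
    rw [bernAvg_congr (G := fun A => (#A : ℝ) ^ 2 + ((-2 * (p * #s)) * #A + (p * #s) ^ 2))
      fun A _ => by ring, bernAvg_add, bernAvg_add, bernAvg_const_mul, bernAvg_const, bernAvg_card,
      h]
    ring
  classical
  induction s using Finset.induction_on with
  | empty => simp [bernAvg_empty]
  | insert a s ha ih =>
    rw [bernAvg_insert ha, ih, bernAvg_congr (G := fun A => (#A : ℝ) ^ 2 + (2 * #A + 1)),
      bernAvg_add, bernAvg_add, bernAvg_const_mul, ih, bernAvg_card, bernAvg_const,
      card_insert_of_notMem ha]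
    · push_cast; ring
    · intro A hA
      rw [card_insert_of_notMem fun h => ha (hA h)]
      push_cast; ring

/-- Since `(1 - τ + τ²/2)(1 + τ + τ²/2) = 1 + τ⁴/4 ≥ 1`, the quadratic lower bound for `exp τ`
inverts to this upper bound. -/
lemma exp_neg_le_quadratic {τ : ℝ} (hτ : 0 ≤ τ) : Real.exp (-τ) ≤ 1 - τ + τ ^ 2 / 2 := by
  have h1 := Real.quadratic_le_exp_of_nonneg hτ
  have h2 : Real.exp (-τ) * Real.exp τ = 1 := by rw [← Real.exp_add]; simp
  have h3 : 0 < 1 - τ + τ ^ 2 / 2 := by nlinarith [sq_nonneg (τ - 1)]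
  refine le_of_mul_le_mul_right ?_ (Real.exp_pos τ)
  rw [h2]
  nlinarith [mul_le_mul_of_nonneg_left h1 h3.le, sq_nonneg (τ ^ 2)]

/-- Induction step of `bernAvg_exp_iSup_mul_le_one` when the optimal interpolation takes place in
the branch containing the new point. With `e = θ - θ²` the factors are at most `1 + p e` and `1 - p
e`. -/
lemma two_point_exp_nonneg {p θ : ℝ} (hp0 : 0 ≤ p) (hp1 : p ≤ 1) (hθ0 : 0 ≤ θ)
    (hθ1 : θ ≤ 1 / 8) :
    (p * Real.exp (θ - 4 * θ ^ 2) + (1 - p)) * (p * Real.exp (-θ) + (1 - p)) ≤ 1 := by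
  have hy0 : 0 ≤ θ - 4 * θ ^ 2 := by nlinarith
  have h1 : Real.exp (θ - 4 * θ ^ 2) ≤ 1 + (θ - θ ^ 2) := by
    have := (abs_le.1 (Real.abs_exp_sub_one_sub_id_le (x := θ - 4 * θ ^ 2)
      (by rw [abs_of_nonneg hy0]; nlinarith))).2
    have : (θ - 4 * θ ^ 2) ^ 2 ≤ θ ^ 2 := pow_le_pow_left₀ hy0 (by nlinarith) 2
    nlinarith
  have h2 : Real.exp (-θ) ≤ 1 - (θ - θ ^ 2) := by
    have := exp_neg_le_quadratic hθ0
    nlinarith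
  have h3 := mul_le_mul_of_nonneg_left h1 hp0
  have h4 := mul_le_mul_of_nonneg_left h2 hp0
  have h5 : 0 ≤ θ - θ ^ 2 := by nlinarith
  calc _ ≤ (1 + p * (θ - θ ^ 2)) * (1 - p * (θ - θ ^ 2)) := by
        refine mul_le_mul (by linarith) (by linarith) ?_ (by positivity)
        have : 0 ≤ 1 - p := by linarith
        positivity
    _ ≤ 1 := by nlinarith [sq_nonneg (p * (θ - θ ^ 2))]

/-- The opposite case of the induction step, where the gain `4pτ²` sits in the branch omitting the
new point. With `e = τ + τ²` the factors are at most `1 - p e` and `1 + p e`; `p ≤ 1/2` enters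
through `3(1 - p) ≥ 3/2`. -/
lemma two_point_exp_nonpos {p τ : ℝ} (hp0 : 0 ≤ p) (hp1 : p ≤ 1 / 2) (hτ0 : 0 ≤ τ)
    (hτ1 : τ ≤ 1 / 8) :
    (p * Real.exp (-τ) + (1 - p) * Real.exp (-(4 * p * τ ^ 2))) * (p * Real.exp τ + (1 - p)) ≤
      1 := by
  have h1 : Real.exp τ ≤ 1 + τ + τ ^ 2 := by
    have := (abs_le.1 (Real.abs_exp_sub_one_sub_id_le (x := τ)
      (by rw [abs_of_nonneg hτ0]; linarith))).2
    linarith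
  have h2 := exp_neg_le_quadratic hτ0
  have hq : 0 ≤ p * τ ^ 2 := by positivity
  have h3 : Real.exp (-(4 * p * τ ^ 2)) ≤ 1 - 3 * (p * τ ^ 2) := by
    have := exp_neg_le_quadratic (τ := 4 * p * τ ^ 2) (by positivity)
    have h : p * τ ^ 2 ≤ 1 / 8 := by nlinarith
    nlinarith
  have h4 := mul_le_mul_of_nonneg_left h1 hp0
  have h5 := mul_le_mul_of_nonneg_left h2 hp0
  have h6 := mul_le_mul_of_nonneg_left h3 (by linarith : 0 ≤ 1 - p)
  have h7 : 3 / 2 * (p * τ ^ 2) ≤ (1 - p) * (3 * (p * τ ^ 2)) := by nlinarith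
  calc _ ≤ (1 - p * (τ + τ ^ 2)) * (1 + p * (τ + τ ^ 2)) := by
        refine mul_le_mul (by linarith) (by linarith) ?_ ?_
        · have : 0 ≤ 1 - p := by linarith
          positivity
        · nlinarith
    _ ≤ 1 := by nlinarith [sq_nonneg (p * (τ + τ ^ 2))]

/-- A convex-distance type inequality for suprema of affine functions of a Bernoulli subset. -/
theorem bernAvg_exp_iSup_mul_le_one {ι : Type*} [Nonempty ι] (hp0 : 0 ≤ p) (hp1 : p ≤ 1 / 2)
    (v : ι → α → ℝ) (hv : ∀ i j, |v i j| ≤ 1 / 8) (s : Finset α) (a : ι → ℝ) {M : ℝ}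
    (ha : ∀ i, |a i| ≤ M) :
    bernAvg p s (fun A => Real.exp (⨆ i, (a i + ∑ j ∈ A, v i j -
        4 * (∑ j ∈ A, v i j ^ 2 + p * ∑ j ∈ s, v i j ^ 2)))) *
      bernAvg p s (fun A => Real.exp (-⨆ i, (a i + ∑ j ∈ A, v i j))) ≤ 1 := by
  classical
  induction s using Finset.induction_on generalizing a M with
  | empty => simp [bernAvg_empty, ← Real.exp_add]
  | insert c s hc ih =>
    have hp1' : p ≤ 1 := by linarith
    have hp2 : 0 ≤ 1 - p := by linarith
    -- A real `⨆` of an unbounded family is `0`, so boundedness has to be carried along; the offsets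
    -- grow by at most `1/8` per point, which is why `M` is generalized in the induction.
    have hbL : ∀ (a : ι → ℝ) (M : ℝ), (∀ i, |a i| ≤ M) → ∀ A : Finset α,
        BddAbove (Set.range fun i => a i + ∑ j ∈ A, v i j) := by
      intro a M ha A
      refine ⟨M + ∑ j ∈ A, 1 / 8, ?_⟩
      rintro _ ⟨i, rfl⟩
      exact add_le_add ((le_abs_self _).trans (ha i))
        (sum_le_sum fun j _ => (le_abs_self _).trans (hv i j))
    have hbQ : ∀ (a : ι → ℝ) (M : ℝ), (∀ i, |a i| ≤ M) → ∀ (A : Finset α) (q : ι → ℝ),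
        (∀ i, 0 ≤ q i) → BddAbove (Set.range fun i => a i + ∑ j ∈ A, v i j - q i) := by
      intro a M ha A q hq
      obtain ⟨C, hC⟩ := hbL a M ha A
      refine ⟨C, ?_⟩
      rintro _ ⟨i, rfl⟩
      have := hC ⟨i, rfl⟩
      have := hq i
      simp only at *
      linarith
    have hpen : ∀ (A : Finset α) i, 0 ≤ 4 * (∑ j ∈ A, v i j ^ 2 + p * ∑ j ∈ s, v i j ^ 2) :=
      fun A i => by positivity
    have ha' : ∀ i, |a i + v i c| ≤ M + 1 / 8 := fun i =>
      (abs_add_le _ _).trans (add_le_add (ha i) (hv i c))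
    set D₀ : Finset α → ℝ := fun A => ⨆ i, (a i + ∑ j ∈ A, v i j -
        4 * (∑ j ∈ A, v i j ^ 2 + p * ∑ j ∈ s, v i j ^ 2)) with hD₀
    set D₁ : Finset α → ℝ := fun A => ⨆ i, (a i + v i c + ∑ j ∈ A, v i j -
        4 * (∑ j ∈ A, v i j ^ 2 + p * ∑ j ∈ s, v i j ^ 2)) with hD₁
    set B₀ : Finset α → ℝ := fun A => ⨆ i, (a i + ∑ j ∈ A, v i j) with hB₀
    set B₁ : Finset α → ℝ := fun A => ⨆ i, (a i + v i c + ∑ j ∈ A, v i j) with hB₁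
    have ih₀ := ih a ha
    have ih₁ := ih (fun i => a i + v i c) ha'
    change bernAvg p s (fun A => Real.exp (D₀ A)) * bernAvg p s (fun A => Real.exp (-B₀ A)) ≤ 1
      at ih₀
    change bernAvg p s (fun A => Real.exp (D₁ A)) * bernAvg p s (fun A => Real.exp (-B₁ A)) ≤ 1
      at ih₁
    have hDle₀ : ∀ A i, a i + ∑ j ∈ A, v i j -
        4 * (∑ j ∈ A, v i j ^ 2 + p * ∑ j ∈ s, v i j ^ 2) ≤ D₀ A := fun A i =>
      le_ciSup (hbQ a M ha A _ (hpen A)) i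
    have hDle₁ : ∀ A i, a i + v i c + ∑ j ∈ A, v i j -
        4 * (∑ j ∈ A, v i j ^ 2 + p * ∑ j ∈ s, v i j ^ 2) ≤ D₁ A := fun A i =>
      le_ciSup (hbQ (fun i => a i + v i c) _ ha' A _ (hpen A)) i
    have hB10 : ∀ A, B₁ A ≤ B₀ A + 1 / 8 := fun A => ciSup_le fun i => by
      have := le_ciSup (hbL a M ha A) i
      have := (abs_le.1 (hv i c)).2
      simp only [hB₀] at *
      linarith
    have hB01 : ∀ A, B₀ A ≤ B₁ A + 1 / 8 := fun A => ciSup_le fun i => by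
      have := le_ciSup (hbL (fun i => a i + v i c) _ ha' A) i
      have := (abs_le.1 (hv i c)).1
      simp only [hB₁] at *
      linarith
    have hY₀pos := bernAvg_exp_pos (s := s) hp0 hp1' (fun A => -B₀ A)
    have hY₁pos := bernAvg_exp_pos (s := s) hp0 hp1' (fun A => -B₁ A)
    -- Logarithms of the two conditional moments. Adding the new point moves each supremum by at
    -- most `1/8`, so `|y₀ - y₁| ≤ 1/8`, which keeps the interpolation weights chosen below
    -- admissible.
    obtain ⟨y₀, hy₀⟩ : ∃ y, bernAvg p s (fun A => Real.exp (-B₀ A)) = Real.exp y :=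
      ⟨_, (Real.exp_log hY₀pos).symm⟩
    obtain ⟨y₁, hy₁⟩ : ∃ y, bernAvg p s (fun A => Real.exp (-B₁ A)) = Real.exp y :=
      ⟨_, (Real.exp_log hY₁pos).symm⟩
    have hX₀ : bernAvg p s (fun A => Real.exp (D₀ A)) ≤ Real.exp (-y₀) := by
      rw [hy₀] at ih₀
      rwa [Real.exp_neg, le_inv_comm₀ (bernAvg_exp_pos hp0 hp1' _) (Real.exp_pos _),
        ← one_div, le_div_iff₀ (bernAvg_exp_pos hp0 hp1' _), mul_comm]
    have hX₁ : bernAvg p s (fun A => Real.exp (D₁ A)) ≤ Real.exp (-y₁) := by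
      rw [hy₁] at ih₁
      rwa [Real.exp_neg, le_inv_comm₀ (bernAvg_exp_pos hp0 hp1' _) (Real.exp_pos _),
        ← one_div, le_div_iff₀ (bernAvg_exp_pos hp0 hp1' _), mul_comm]
    have hθ1 : y₀ - y₁ ≤ 1 / 8 := by
      have h : bernAvg p s (fun A => Real.exp (-B₀ A)) ≤
          bernAvg p s (fun A => Real.exp (1 / 8) * Real.exp (-B₁ A)) := by
        refine bernAvg_mono hp0 hp1' fun A _ => ?_
        rw [← Real.exp_add]
        exact Real.exp_le_exp.2 (by have := hB10 A; linarith)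
      rw [bernAvg_const_mul, hy₀, hy₁, ← Real.exp_add, Real.exp_le_exp] at h
      linarith
    have hθ2 : y₁ - y₀ ≤ 1 / 8 := by
      have h : bernAvg p s (fun A => Real.exp (-B₁ A)) ≤
          bernAvg p s (fun A => Real.exp (1 / 8) * Real.exp (-B₀ A)) := by
        refine bernAvg_mono hp0 hp1' fun A _ => ?_
        rw [← Real.exp_add]
        exact Real.exp_le_exp.2 (by have := hB01 A; linarith)
      rw [bernAvg_const_mul, hy₀, hy₁, ← Real.exp_add, Real.exp_le_exp] at h
      linarith
    have hsecond : bernAvg p (insert c s) (fun A => Real.exp (-⨆ i, (a i + ∑ j ∈ A, v i j))) =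
        (1 - p) * Real.exp y₀ + p * Real.exp y₁ := by
      rw [bernAvg_insert hc, ← hy₀, ← hy₁]
      congr 2
      refine bernAvg_congr fun A hA => ?_
      simp only [hB₁, sum_insert fun h => hc (hA h), add_assoc]
    -- Each branch may mix the two induction hypotheses by Hölder. Mixing costs a term linear in `v
    -- i c`, which the new part of the penalty, `4p (v i c)²` or `4(1 + p)(v i c)²`, absorbs by
    -- completing the square, leaving `t₀²/(16p)` or `t₁²/16`.
    have hfirst : ∀ t₀ t₁, 0 ≤ t₀ → t₀ ≤ p → 0 ≤ t₁ → t₁ ≤ 1 →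
        bernAvg p (insert c s) (fun A => Real.exp (⨆ i, (a i + ∑ j ∈ A, v i j -
          4 * (∑ j ∈ A, v i j ^ 2 + p * ∑ j ∈ insert c s, v i j ^ 2)))) ≤
        (1 - p) * Real.exp ((1 - t₀) * -y₀ + t₀ * -y₁ + t₀ * (t₀ / p) / 16) +
          p * Real.exp ((1 - t₁) * -y₁ + t₁ * -y₀ + t₁ ^ 2 / 16) := by
      intro t₀ t₁ h1 h2 h3 h4
      have h5 : t₀ ≤ 1 := by linarith
      rw [bernAvg_insert hc]
      refine add_le_add (mul_le_mul_of_nonneg_left ?_ hp2) (mul_le_mul_of_nonneg_left ?_ hp0)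
      · rw [add_comm _ (t₀ * (t₀ / p) / 16), Real.exp_add]
        refine le_trans ?_ (mul_le_mul_of_nonneg_left
          (bernAvg_exp_convexComb_le hp0 hp1' h1 h5 hX₀ hX₁) (Real.exp_pos _).le)
        rw [← bernAvg_const_mul]
        refine bernAvg_mono hp0 hp1' fun A hA => ?_
        rw [← Real.exp_add, Real.exp_le_exp]
        refine ciSup_le fun i => ?_
        have e0 := mul_le_mul_of_nonneg_left (hDle₀ A i) (sub_nonneg.2 h5)
        have e1 := mul_le_mul_of_nonneg_left (hDle₁ A i) h1
        rw [sum_insert hc]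
        have e2 : -(t₀ * v i c) ≤ t₀ * (t₀ / p) / 16 + 4 * (p * v i c ^ 2) := by
          rcases hp0.eq_or_lt with h | h
          · have : t₀ = 0 := by linarith
            simp [this, ← h]
          · have e3 : t₀ * (t₀ / p) / 16 + 4 * (p * v i c ^ 2) + t₀ * v i c =
              (t₀ / 4 + 2 * p * v i c) ^ 2 / p := by field_simp; ring
            have e4 : 0 ≤ (t₀ / 4 + 2 * p * v i c) ^ 2 / p := by positivity
            linarith
        nlinarith
      · rw [add_comm _ (t₁ ^ 2 / 16), Real.exp_add]
        refine le_trans ?_ (mul_le_mul_of_nonneg_left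
          (bernAvg_exp_convexComb_le hp0 hp1' h3 h4 hX₁ hX₀) (Real.exp_pos _).le)
        rw [← bernAvg_const_mul]
        refine bernAvg_mono hp0 hp1' fun A hA => ?_
        rw [← Real.exp_add, Real.exp_le_exp]
        refine ciSup_le fun i => ?_
        have e0 := mul_le_mul_of_nonneg_left (hDle₀ A i) h3
        have e1 := mul_le_mul_of_nonneg_left (hDle₁ A i) (sub_nonneg.2 h4)
        rw [sum_insert hc, sum_insert fun h => hc (hA h), sum_insert fun h => hc (hA h)]
        have e2 : t₁ * v i c ≤ t₁ ^ 2 / 16 + 4 * v i c ^ 2 := by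
          nlinarith [sq_nonneg (t₁ / 4 - 2 * v i c)]
        have e3 : 0 ≤ p * v i c ^ 2 := by positivity
        nlinarith
    rw [hsecond]
    have hpos : 0 ≤ (1 - p) * Real.exp y₀ + p * Real.exp y₁ := by positivity
    rcases le_total y₁ y₀ with h | h
    -- `t₁ = 8(y₀ - y₁)` minimizes `-t₁(y₀ - y₁) + t₁²/16`, with minimum `-4(y₀ - y₁)²`.
    · refine le_trans (mul_le_mul_of_nonneg_right
        (hfirst 0 (8 * (y₀ - y₁)) le_rfl hp0 (by linarith) (by linarith)) hpos) ?_
      refine le_trans (le_of_eq ?_)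
        (two_point_exp_nonneg (θ := y₀ - y₁) hp0 hp1' (by linarith) hθ1)
      have e1 : Real.exp (-(y₀ - y₁)) = Real.exp (-y₀) * Real.exp y₁ := by
        rw [← Real.exp_add]; ring_nf
      have e2 : Real.exp ((1 - 8 * (y₀ - y₁)) * -y₁ + 8 * (y₀ - y₁) * -y₀ +
          (8 * (y₀ - y₁)) ^ 2 / 16) =
          Real.exp (-y₀) * Real.exp ((y₀ - y₁) - 4 * (y₀ - y₁) ^ 2) := by
        rw [← Real.exp_add]; ring_nf
      have e3 : Real.exp (-y₀) * Real.exp y₀ = 1 := by rw [← Real.exp_add]; simp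
      rw [e1, e2]
      simp only [sub_zero, one_mul, zero_mul, add_zero, zero_div]
      linear_combination ((1 - p) + p * Real.exp ((y₀ - y₁) - 4 * (y₀ - y₁) ^ 2)) * (1 - p) * e3
    -- `t₀ = 8p(y₁ - y₀)` minimizes `-t₀(y₁ - y₀) + t₀²/(16p)`, with minimum `-4p(y₁ - y₀)²`.
    · refine le_trans (mul_le_mul_of_nonneg_right
        (hfirst (8 * p * (y₁ - y₀)) 0 (mul_nonneg (by positivity) (by linarith)) (by nlinarith)
          le_rfl zero_le_one) hpos) ?_
      refine le_trans (le_of_eq ?_)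
        (two_point_exp_nonpos (τ := y₁ - y₀) hp0 hp1 (by linarith) hθ2)
      have e1 : Real.exp (y₁ - y₀) = Real.exp (-y₀) * Real.exp y₁ := by
        rw [← Real.exp_add]; ring_nf
      have e4 : Real.exp (-(y₁ - y₀)) = Real.exp y₀ * Real.exp (-y₁) := by
        rw [← Real.exp_add]; ring_nf
      have e2 : Real.exp ((1 - 8 * p * (y₁ - y₀)) * -y₀ + 8 * p * (y₁ - y₀) * -y₁ +
          8 * p * (y₁ - y₀) * (8 * p * (y₁ - y₀) / p) / 16) =
          Real.exp (-y₀) * Real.exp (-(4 * p * (y₁ - y₀) ^ 2)) := by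
        rw [← Real.exp_add]
        congr 1
        rcases hp0.eq_or_lt with h | h
        · subst h; simp
        · field_simp; ring
      have e3 : Real.exp (-y₀) * Real.exp y₀ = 1 := by rw [← Real.exp_add]; simp
      rw [e1, e2, e4]
      simp only [sub_zero, one_mul, zero_mul, add_zero, zero_div, zero_pow two_ne_zero]
      linear_combination ((1 - p) ^ 2 * Real.exp (-(4 * p * (y₁ - y₀) ^ 2)) -
        p ^ 2 * (Real.exp (-y₁) * Real.exp y₁)) * e3

end Bernoulli

/-! ### Averages over all sets of a given cardinality -/

section Orbit

variable {α : Type*} [Fintype α]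

lemma bernAvg_map (p : ℝ) (F : Finset α → ℝ) (σ : Equiv.Perm α) :
    bernAvg p univ (fun A => F (A.map σ.toEmbedding)) = bernAvg p univ F := by
  unfold bernAvg
  simp only [powerset_univ]
  refine Fintype.sum_equiv σ.finsetCongr _ _ fun A => ?_
  simp

/-- Nestedness is what makes stabilizer averages computable: a set nested with `S` is spread evenly
over `S`, or evenly outside `S`. -/
lemma exists_card_eq_nested {S : Finset α} {N : ℕ} (hN : N ≤ Fintype.card α) :
    ∃ B : Finset α, #B = N ∧ (B ⊆ S ∨ S ⊆ B) := by
  rcases le_total N #S with h | h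
  · obtain ⟨B, hB, hc⟩ := exists_subset_card_eq h
    exact ⟨B, hc, Or.inl hB⟩
  · obtain ⟨B, hB, -, hc⟩ := exists_subsuperset_card_eq (subset_univ S) h (by simpa using hN)
    exact ⟨B, hc, Or.inr hB⟩

variable [DecidableEq α]

/-- The average of `F` over all sets of the same cardinality as `A`, as an average over all
permutations of the points. -/
def orbitAvg (F : Finset α → ℝ) (A : Finset α) : ℝ :=
  (∑ σ : Equiv.Perm α, F (A.map σ.toEmbedding)) / Fintype.card (Equiv.Perm α)

lemma orbitAvg_add (F G : Finset α → ℝ) (A : Finset α) :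
    orbitAvg (fun A => F A + G A) A = orbitAvg F A + orbitAvg G A := by
  simp [orbitAvg, sum_add_distrib, add_div]

lemma orbitAvg_const_mul (c : ℝ) (F : Finset α → ℝ) (A : Finset α) :
    orbitAvg (fun A => c * F A) A = c * orbitAvg F A := by
  simp [orbitAvg, ← mul_sum, mul_div_assoc]

lemma orbitAvg_const (c : ℝ) (A : Finset α) : orbitAvg (fun _ => c) A = c := by
  have h : (Fintype.card (Equiv.Perm α) : ℝ) ≠ 0 := by positivity
  simp only [orbitAvg, sum_const, card_univ, nsmul_eq_mul]
  field_simp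

lemma orbitAvg_mono {F G : Finset α → ℝ} {A : Finset α} (h : ∀ B, #B = #A → F B ≤ G B) :
    orbitAvg F A ≤ orbitAvg G A :=
  div_le_div_of_nonneg_right (sum_le_sum fun _ _ => h _ (card_map _)) (by positivity)

lemma orbitAvg_map (F : Finset α → ℝ) (A : Finset α) (ρ : Equiv.Perm α) :
    orbitAvg F (A.map ρ.toEmbedding) = orbitAvg F A := by
  unfold orbitAvg
  congr 1
  refine Fintype.sum_equiv (Equiv.mulRight ρ) _ _ fun σ => ?_
  rw [map_map]
  rfl

lemma exists_perm_map_eq {A B : Finset α} (h : #A = #B) :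
    ∃ ρ : Equiv.Perm α, A.map ρ.toEmbedding = B := by
  have e : {x // x ∈ A} ≃ {x // x ∈ B} := Fintype.equivOfCardEq (by simpa using h)
  refine ⟨e.extendSubtype, eq_of_subset_of_card_le ?_ (by simp [h])⟩
  intro x hx
  obtain ⟨a, ha, rfl⟩ := mem_map.1 hx
  exact e.extendSubtype_mem a ha

lemma orbitAvg_eq_of_card_eq (F : Finset α → ℝ) {A B : Finset α} (h : #A = #B) :
    orbitAvg F A = orbitAvg F B := by
  obtain ⟨ρ, rfl⟩ := exists_perm_map_eq h
  rw [orbitAvg_map]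

lemma map_perm_compl (A : Finset α) (σ : Equiv.Perm α) :
    Aᶜ.map σ.toEmbedding = (A.map σ.toEmbedding)ᶜ := by
  ext x
  simp

lemma orbitAvg_compl (F : Finset α → ℝ) (A : Finset α) :
    orbitAvg (fun B => F Bᶜ) A = orbitAvg F Aᶜ := by
  simp only [orbitAvg, map_perm_compl]

/-- The Bernoulli weight of a set depends only on its cardinality, so the law is invariant under
permutations and may be averaged over them. -/
lemma bernAvg_orbitAvg (p : ℝ) (F : Finset α → ℝ) :
    bernAvg p univ (orbitAvg F) = bernAvg p univ F := by
  have h : (Fintype.card (Equiv.Perm α) : ℝ) ≠ 0 := by positivity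
  have h1 : bernAvg p univ (orbitAvg F) = (∑ σ : Equiv.Perm α,
      bernAvg p univ (fun A => F (A.map σ.toEmbedding))) / Fintype.card (Equiv.Perm α) := by
    simp only [bernAvg, orbitAvg, mul_div_assoc', mul_sum]
    rw [← sum_div, sum_comm]
  rw [h1]
  simp only [bernAvg_map, sum_const, card_univ, nsmul_eq_mul]
  field_simp

/-- Averaging over the stabilizer of `S` spreads a subset of `S` evenly over `S`. -/
lemma exists_stabilizer_avg_subset {S : Finset α} (hS : S.Nonempty) :
    ∃ H : Finset (Equiv.Perm α), H.Nonempty ∧ ∀ A ⊆ S, ∀ v : α → ℝ,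
      ∑ ρ ∈ H, ∑ i ∈ A.map ρ.toEmbedding, v i = #H * ((#A : ℝ) / #S * ∑ i ∈ S, v i) := by
  set H : Finset (Equiv.Perm α) := univ.filter fun ρ => S.map ρ.toEmbedding = S with hH
  refine ⟨H, ⟨1, by rw [hH, mem_filter]; exact ⟨mem_univ _, map_refl⟩⟩, fun A hA v => ?_⟩
  -- Transpositions of two points of `S` stabilize `S`, so right multiplication by one of them
  -- reindexes `H`.
  have hconst : ∀ a ∈ S, ∀ b ∈ S, ∑ ρ ∈ H, v (ρ a) = ∑ ρ ∈ H, v (ρ b) := by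
    intro a ha b hb
    have hsw : S.map (Equiv.swap a b).toEmbedding = S := by
      refine eq_of_subset_of_card_le (fun x hx => ?_) (by simp)
      obtain ⟨y, hy, rfl⟩ := mem_map.1 hx
      simp only [Equiv.coe_toEmbedding]
      by_cases h1 : y = a
      · subst h1; simpa using hb
      by_cases h2 : y = b
      · subst h2; simpa using ha
      rwa [Equiv.swap_apply_of_ne_of_ne h1 h2]
    refine sum_bij' (fun ρ _ => ρ * Equiv.swap a b) (fun ρ _ => ρ * Equiv.swap a b) ?_ ?_ ?_ ?_ ?_
    · intro ρ hρ
      rw [hH, mem_filter] at hρ ⊢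
      refine ⟨mem_univ _, ?_⟩
      have : S.map (ρ * Equiv.swap a b).toEmbedding =
        (S.map (Equiv.swap a b).toEmbedding).map ρ.toEmbedding := by rw [map_map]; rfl
      rw [this, hsw, hρ.2]
    · intro ρ hρ
      rw [hH, mem_filter] at hρ ⊢
      refine ⟨mem_univ _, ?_⟩
      have : S.map (ρ * Equiv.swap a b).toEmbedding =
        (S.map (Equiv.swap a b).toEmbedding).map ρ.toEmbedding := by rw [map_map]; rfl
      rw [this, hsw, hρ.2]
    · intro ρ _; simp [mul_assoc]
    · intro ρ _; simp [mul_assoc]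
    · intro ρ _; simp
  obtain ⟨a₀, ha₀⟩ := hS
  have hS0 : (#S : ℝ) ≠ 0 := by
    have : 0 < #S := card_pos.2 ⟨a₀, ha₀⟩
    positivity
  have hsum : ∀ B ⊆ S, ∑ ρ ∈ H, ∑ i ∈ B.map ρ.toEmbedding, v i =
      #B * ∑ ρ ∈ H, v (ρ a₀) := by
    intro B hB
    simp only [sum_map, Equiv.coe_toEmbedding]
    rw [sum_comm, sum_congr rfl fun b hb => hconst b (hB hb) a₀ ha₀]
    simp
  have h1 := hsum S subset_rfl
  rw [sum_congr rfl fun ρ hρ => by rw [(mem_filter.1 hρ).2]] at h1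
  rw [hsum A hA]
  simp only [sum_const, nsmul_eq_mul] at h1
  field_simp
  linear_combination -(#A : ℝ) * h1

/-- Averaging over the stabilizer of `S` spreads a superset of `S` evenly outside `S`. -/
lemma exists_stabilizer_avg_superset {S : Finset α} (hS : #S < Fintype.card α) :
    ∃ H : Finset (Equiv.Perm α), H.Nonempty ∧ ∀ A, S ⊆ A → ∀ v : α → ℝ,
      ∑ ρ ∈ H, ∑ i ∈ A.map ρ.toEmbedding, v i = #H * (∑ i ∈ S, v i +
        ((#A : ℝ) - #S) / (Fintype.card α - #S) * (∑ i, v i - ∑ i ∈ S, v i)) := by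
  have hSc : (#Sᶜ : ℝ) = Fintype.card α - #S := by
    rw [card_compl, Nat.cast_sub hS.le]
  have hpos : (0 : ℝ) < Fintype.card α - #S := by
    have : (#S : ℝ) < Fintype.card α := by exact_mod_cast hS
    linarith
  obtain ⟨H, hH, h⟩ := exists_stabilizer_avg_subset (S := Sᶜ)
    (card_pos.1 (by rw [card_compl]; omega))
  refine ⟨H, hH, fun A hA v => ?_⟩
  have h1 := h Aᶜ (compl_subset_compl.2 hA) v
  have h2 : ∀ B : Finset α, ∑ i ∈ Bᶜ, v i = ∑ i, v i - ∑ i ∈ B, v i := fun B => by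
    rw [← sum_compl_add_sum B]; ring
  have hAc : (#Aᶜ : ℝ) = Fintype.card α - #A := by
    rw [card_compl, Nat.cast_sub (card_le_univ A)]
  simp only [map_perm_compl, h2, sum_sub_distrib, sum_const, nsmul_eq_mul, hAc, hSc] at h1
  have h3 : (Fintype.card α - #A : ℝ) / (Fintype.card α - #S) =
      1 - ((#A : ℝ) - #S) / (Fintype.card α - #S) := by field_simp; ring
  rw [h3] at h1
  linear_combination -h1

end Orbit

/-! ### Suprema of deviations over slices and over Bernoulli subsets -/

section SupDev

variable {α ι : Type*} [Fintype α]

/-- The largest deviation of `∑ j ∈ A, w i j` from `p * ∑ j, w i j`. -/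
def supDev (p : ℝ) (w : ι → α → ℝ) (A : Finset α) : ℝ :=
  ⨆ i, (∑ j ∈ A, w i j - p * ∑ j, w i j)

variable {p M : ℝ} {w : ι → α → ℝ}

lemma abs_sum_sub_le (hw : ∀ i j, |w i j| ≤ M) (A : Finset α) (i : ι) :
    |∑ j ∈ A, w i j - p * ∑ j, w i j| ≤ #A * M + |p| * (Fintype.card α * M) := by
  have h : ∀ B : Finset α, |∑ j ∈ B, w i j| ≤ #B * M := fun B => by
    refine (abs_sum_le_sum_abs _ _).trans ((sum_le_sum fun j _ => hw i j).trans_eq ?_)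
    simp
  refine (abs_sub _ _).trans (add_le_add (h A) ?_)
  rw [abs_mul]
  exact mul_le_mul_of_nonneg_left (h univ) (abs_nonneg p)

lemma bddAbove_dev (hw : ∀ i j, |w i j| ≤ M) (A : Finset α) :
    BddAbove (Set.range fun i => ∑ j ∈ A, w i j - p * ∑ j, w i j) := by
  refine ⟨#A * M + |p| * (Fintype.card α * M), ?_⟩
  rintro _ ⟨i, rfl⟩
  exact (le_abs_self _).trans (abs_sum_sub_le hw A i)

lemma le_supDev (hw : ∀ i j, |w i j| ≤ M) (A : Finset α) (i : ι) :
    ∑ j ∈ A, w i j - p * ∑ j, w i j ≤ supDev p w A :=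
  le_ciSup (bddAbove_dev hw A) i

lemma supDev_nonneg (hw : ∀ i j, |w i j| ≤ M) {i₀ : ι} (h₀ : ∀ j, w i₀ j = 0) (A : Finset α) :
    0 ≤ supDev p w A := by
  simpa [h₀] using le_supDev (p := p) hw A i₀

lemma supDev_map (A : Finset α) (σ : Equiv.Perm α) :
    supDev p w (A.map σ.toEmbedding) = supDev p (fun i j => w i (σ j)) A := by
  unfold supDev
  congr 1
  ext i
  rw [sum_map, Equiv.sum_comp σ (w i)]
  rfl

lemma exp_avg_le {β : Type*} {H : Finset β} (hH : H.Nonempty) (f : β → ℝ) :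
    Real.exp ((∑ ρ ∈ H, f ρ) / #H) ≤ (∑ ρ ∈ H, Real.exp (f ρ)) / #H := by
  have hc : (#H : ℝ) ≠ 0 := by have := card_pos.2 hH; positivity
  have h := convexOn_exp.map_sum_le (t := H) (w := fun _ => (#H : ℝ)⁻¹) (p := f)
    (fun _ _ => by positivity) (by simp [hc]) (fun _ _ => Set.mem_univ _)
  simpa [← mul_sum, div_eq_inv_mul] using h

/-- The size of the contraction in passing from a slice to a nested set of size `N`. -/
def nestedRatio (n k N : ℝ) : ℝ := min (N / k) ((n - N) / (n - k))

/-- A quadratic minorant, so that only the mean and variance of `N` matter later. With `x = N - k`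
the ratio is the minimum of the lines `1 + x/k` and `1 - x/(n - k)`. The linear coefficient is the
mean of their slopes, and the remaining `V|x|/2` is at most `1/3 + 3Vx²/8` because `V = 1/k + 1/(n -
k) ≤ 2`. -/
lemma nestedRatio_ge {n k : ℝ} (hk : 1 ≤ k) (hn : k + 1 ≤ n) (N : ℝ) :
    2 / 3 - (1 / (n - k) - 1 / k) / 2 * (N - k) - 3 / 8 * (n / (k * (n - k))) * (N - k) ^ 2 ≤
      nestedRatio n k N := by
  have hk0 : 0 < k := by linarith
  have hnk : 0 < n - k := by linarith
  have hV : n / (k * (n - k)) ≤ 2 := by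
    rw [div_le_iff₀ (by positivity)]
    nlinarith
  set V := n / (k * (n - k)) with hVdef
  have hV0 : 0 < V := by
    have : 0 < n := by linarith
    positivity
  have h1 : 1 / k + 1 / (n - k) = V := by rw [hVdef]; field_simp; ring
  have key : ∀ x : ℝ, 0 ≤ 1 / 3 + V / 2 * x + 3 / 8 * V * x ^ 2 := fun x => by
    nlinarith [mul_nonneg hV0.le (sq_nonneg (x + 2 / 3))]
  unfold nestedRatio
  rw [le_min_iff]
  have e1 : N / k = 1 + (N - k) * (1 / k) := by field_simp; ring
  have e2 : (n - N) / (n - k) = 1 - (N - k) * (1 / (n - k)) := by field_simp; ring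
  rw [e1, e2]
  constructor
  · have h := key (N - k)
    rw [← h1] at h ⊢
    nlinarith
  · have h := key (-(N - k))
    rw [← h1] at h ⊢
    nlinarith

/-- The size of a Bernoulli set has mean `k` and variance `k(n - k)/n`, so the quadratic minorant
averages to `2/3 - 3/8 = 7/24`. -/
lemma bernAvg_nestedRatio_ge {k : ℕ} (hk : 1 ≤ k) (hn : k < Fintype.card α)
    (hp : p = k / Fintype.card α) :
    1 / 4 ≤ bernAvg p univ (fun A : Finset α => nestedRatio (Fintype.card α) k #A) := by
  have hk' : (1 : ℝ) ≤ k := by exact_mod_cast hk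
  have hn' : (k : ℝ) + 1 ≤ Fintype.card α := by exact_mod_cast hn
  set n : ℝ := ((Fintype.card α : ℕ) : ℝ) with hndef
  have hn0 : 0 < n := by linarith
  have hnk : 0 < n - k := by linarith
  have hp0 : 0 ≤ p := by rw [hp]; positivity
  have hp1 : p ≤ 1 := by rw [hp, div_le_one hn0]; linarith
  have hpn : p * n = k := by rw [hp]; field_simp
  refine le_trans ?_ (bernAvg_mono hp0 hp1 fun A _ => nestedRatio_ge hk' hn' #A)
  have h1 : bernAvg p univ (fun A : Finset α => (#A : ℝ)) = k := by
    rw [bernAvg_card, card_univ, ← hndef, hpn]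
  have h2 : bernAvg p univ (fun A : Finset α => ((#A : ℝ) - k) ^ 2) = k * (n - k) / n := by
    have := bernAvg_card_sub_sq (p := p) (s := (univ : Finset α))
    rw [card_univ, ← hndef, hpn] at this
    rw [this, hp]
    field_simp
  rw [bernAvg_congr (G := fun A : Finset α => (2 / 3 + (1 / (n - k) - 1 / k) / 2 * k) +
    ((-((1 / (n - k) - 1 / k) / 2)) * #A + (-(3 / 8 * (n / (k * (n - k))))) * ((#A : ℝ) - k) ^ 2))
    fun A _ => by ring, bernAvg_add, bernAvg_const, bernAvg_add, bernAvg_const_mul,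
    bernAvg_const_mul, h1, h2]
  have : -(3 / 8 * (n / (k * (n - k)))) * (k * (n - k) / n) = -(3 / 8) := by
    field_simp
  rw [this]
  linarith

variable {i₀ : ι}

/-- Exponential moments of suprema with a self-bounding variance over Bernoulli subsets. -/
lemma bernAvg_exp_supDev_le (hp0 : 0 ≤ p) (hp1 : p ≤ 1 / 2) (hw : ∀ i j, |w i j| ≤ M)
    (h₀ : ∀ j, w i₀ j = 0) {θ Q R : ℝ} (hθ : 0 < θ) (hθM : θ * M ≤ 1 / 8)
    (hθQ : 8 * θ * Q ≤ 1)
    (hV : ∀ A i, ∑ j ∈ A, w i j ^ 2 + p * ∑ j, w i j ^ 2 ≤ Q * (R + supDev p w A)) :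
    bernAvg p univ (fun A => Real.exp (θ / 2 * supDev p w A)) ≤
      Real.exp (θ * bernAvg p univ (supDev p w) + 4 * θ ^ 2 * Q * R) := by
  have hp1' : p ≤ 1 := by linarith
  have hne : Nonempty ι := ⟨i₀⟩
  have hmain := bernAvg_exp_iSup_mul_le_one hp0 hp1 (fun i j => θ * w i j)
    (fun i j => by
      rw [abs_mul, abs_of_pos hθ]
      exact (mul_le_mul_of_nonneg_left (hw i j) hθ.le).trans hθM)
    univ (fun i => θ * -(p * ∑ j, w i j)) (M := θ * (|p| * (Fintype.card α * M)))
    (fun i => by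
      rw [abs_mul, abs_of_pos hθ, abs_neg]
      have := abs_sum_sub_le (p := p) hw ∅ i
      exact mul_le_mul_of_nonneg_left (by simpa using this) hθ.le)
  have h1 : ∀ A : Finset α, ⨆ i, (θ * -(p * ∑ j, w i j) + ∑ j ∈ A, θ * w i j) =
      θ * supDev p w A := by
    intro A
    rw [supDev, Real.mul_iSup_of_nonneg hθ.le]
    congr 1
    ext i
    rw [← mul_sum]
    ring
  -- Self-bounding: the penalty is at most `4θ²QR + 4θ²Q · supDev`, and `8θQ ≤ 1` lets half of `θ ·
  -- supDev` absorb the random part.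
  have h2 : ∀ A : Finset α, θ / 2 * supDev p w A - 4 * θ ^ 2 * Q * R ≤
      ⨆ i, (θ * -(p * ∑ j, w i j) + ∑ j ∈ A, θ * w i j -
        4 * (∑ j ∈ A, (θ * w i j) ^ 2 + p * ∑ j, (θ * w i j) ^ 2)) := by
    intro A
    have hbdd : BddAbove (Set.range fun i => θ * -(p * ∑ j, w i j) + ∑ j ∈ A, θ * w i j -
        4 * (∑ j ∈ A, (θ * w i j) ^ 2 + p * ∑ j, (θ * w i j) ^ 2)) := by
      refine ⟨θ * supDev p w A, ?_⟩
      rintro _ ⟨i, rfl⟩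
      have h3 := mul_le_mul_of_nonneg_left (le_supDev (p := p) hw A i) hθ.le
      have h4 : 0 ≤ 4 * (∑ j ∈ A, (θ * w i j) ^ 2 + p * ∑ j, (θ * w i j) ^ 2) := by positivity
      simp only [← mul_sum] at *
      linarith
    have hg0 := supDev_nonneg (p := p) hw h₀ A
    have h5 : θ * supDev p w A ≤ (⨆ i, (θ * -(p * ∑ j, w i j) + ∑ j ∈ A, θ * w i j -
        4 * (∑ j ∈ A, (θ * w i j) ^ 2 + p * ∑ j, (θ * w i j) ^ 2))) +
          4 * θ ^ 2 * (Q * (R + supDev p w A)) := by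
      rw [← h1]
      refine ciSup_le fun i => ?_
      have h6 := le_ciSup hbdd i
      have h7 := mul_le_mul_of_nonneg_left (hV A i) (by positivity : 0 ≤ 4 * θ ^ 2)
      simp only [mul_pow, ← mul_sum] at *
      linarith
    have h8 : 4 * θ ^ 2 * Q * supDev p w A ≤ θ / 2 * supDev p w A :=
      mul_le_mul_of_nonneg_right (by nlinarith) hg0
    linarith
  simp only [h1] at hmain
  have hJ : Real.exp (-(θ * bernAvg p univ (supDev p w))) ≤
      bernAvg p univ (fun A => Real.exp (-(θ * supDev p w A))) := by
    rw [← neg_mul, ← bernAvg_const_mul]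
    simp only [neg_mul]
    exact exp_bernAvg_le hp0 hp1' _
  have hL : Real.exp (-(4 * θ ^ 2 * Q * R)) *
      bernAvg p univ (fun A => Real.exp (θ / 2 * supDev p w A)) ≤
      bernAvg p univ (fun A => Real.exp (⨆ i, (θ * -(p * ∑ j, w i j) + ∑ j ∈ A, θ * w i j -
        4 * (∑ j ∈ A, (θ * w i j) ^ 2 + p * ∑ j, (θ * w i j) ^ 2)))) := by
    rw [← bernAvg_const_mul]
    refine bernAvg_mono hp0 hp1' fun A _ => ?_
    rw [← Real.exp_add]
    exact Real.exp_le_exp.2 (by have := h2 A; linarith)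
  have hfin := (mul_le_mul hL hJ (Real.exp_pos _).le
    (bernAvg_exp_pos hp0 hp1' _).le).trans hmain
  rw [mul_right_comm, ← Real.exp_add, mul_comm, ← le_div_iff₀ (Real.exp_pos _), one_div,
    ← Real.exp_neg] at hfin
  refine hfin.trans_eq ?_
  congr 1; ring

variable [DecidableEq α]

/-- Deviations over a set are averages of deviations over nested sets. -/
lemma exists_nested_avg {S : Finset α} (hS : 1 ≤ #S) (hSn : #S < Fintype.card α)
    (A : Finset α) :
    ∃ (B : Finset α) (H : Finset (Equiv.Perm α)), #B = #A ∧ H.Nonempty ∧ ∀ v : α → ℝ,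
      (∑ ρ ∈ H, ∑ i ∈ B.map ρ.toEmbedding, v i) / #H =
        nestedRatio (Fintype.card α) #S #A *
          (∑ i ∈ S, v i - (#S : ℝ) / Fintype.card α * ∑ i, v i) +
        (#A : ℝ) / Fintype.card α * ∑ i, v i := by
  have hS0 : (0 : ℝ) < #S := by exact_mod_cast hS
  have hSn' : (0 : ℝ) < Fintype.card α - #S := by
    have : (#S : ℝ) < Fintype.card α := by exact_mod_cast hSn
    linarith
  have hn : (0 : ℝ) < Fintype.card α := by linarith
  obtain ⟨B, hB, hnest⟩ := exists_card_eq_nested (S := S) (card_le_univ A)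
  rcases hnest with h | h
  · obtain ⟨H, hH, hav⟩ := exists_stabilizer_avg_subset (card_pos.1 hS)
    have hH0 : (#H : ℝ) ≠ 0 := by have := card_pos.2 hH; positivity
    refine ⟨B, H, hB, hH, fun v => ?_⟩
    have hc : (#A : ℝ) ≤ #S := by rw [← hB]; exact_mod_cast card_le_card h
    have hr : nestedRatio (Fintype.card α) #S #A = (#A : ℝ) / #S := by
      refine min_eq_left ?_
      rw [div_le_div_iff₀ hS0 hSn']
      nlinarith
    rw [hav B h v, hr, hB]
    field_simp
    ring
  · obtain ⟨H, hH, hav⟩ := exists_stabilizer_avg_superset hSn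
    have hH0 : (#H : ℝ) ≠ 0 := by have := card_pos.2 hH; positivity
    refine ⟨B, H, hB, hH, fun v => ?_⟩
    have hc : (#S : ℝ) ≤ #A := by rw [← hB]; exact_mod_cast card_le_card h
    have hr : nestedRatio (Fintype.card α) #S #A =
        (Fintype.card α - #A : ℝ) / (Fintype.card α - #S) := by
      refine min_eq_right ?_
      rw [div_le_div_iff₀ hSn' hS0]
      nlinarith
    rw [hav B h v, hr, hB]
    field_simp
    ring

/-- Exponential moments over a slice are controlled by those over Bernoulli subsets. -/
lemma orbitAvg_exp_supDev_le (hw : ∀ i j, |w i j| ≤ M) (h₀ : ∀ j, w i₀ j = 0) {S : Finset α}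
    (hS : 1 ≤ #S) (hSn : #S < Fintype.card α) (hp : p = #S / Fintype.card α) {θ : ℝ}
    (hθ : 0 ≤ θ) :
    orbitAvg (fun A => Real.exp (θ / 4 * supDev p w A)) S ≤
      bernAvg p univ (fun A => Real.exp (θ * supDev p w A)) := by
  have hn0 : (0 : ℝ) < Fintype.card α := by exact_mod_cast (by omega : 0 < Fintype.card α)
  have hp0 : 0 ≤ p := by rw [hp]; positivity
  have hp1 : p ≤ 1 := by
    rw [hp, div_le_one hn0]; exact_mod_cast hSn.le
  choose B H hB hH hav using exists_nested_avg hS hSn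
  have hne : Nonempty ι := ⟨i₀⟩
  have hH0 : ∀ A, (0 : ℝ) < #(H A) := fun A => by have := card_pos.2 (hH A); positivity
  -- Each deviation over `S`, times the mean nested ratio, is a Bernoulli average of deviations over
  -- sets nested with `S`: the centering terms cancel because `#A` has mean `p n`. The claim is made
  -- for every `w` so that it can be applied to the relabelled families `w i (σ j)`.
  have hlin : ∀ w : ι → α → ℝ, (∀ i j, |w i j| ≤ M) → (∀ j, w i₀ j = 0) →
      1 / 4 * supDev p w S ≤
        bernAvg p univ fun A => (∑ ρ ∈ H A, supDev p w ((B A).map ρ.toEmbedding)) / #(H A) := by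
    intro w hw h₀
    have hc := bernAvg_nestedRatio_ge hS hSn hp
    refine (mul_le_mul_of_nonneg_right hc (supDev_nonneg hw h₀ S)).trans ?_
    have hcpos := (by norm_num : (0 : ℝ) < 1 / 4).trans_le hc
    rw [mul_comm, ← le_div_iff₀ hcpos]
    refine ciSup_le fun i => ?_
    rw [le_div_iff₀ hcpos, mul_comm]
    have e : bernAvg p univ (fun A : Finset α => nestedRatio (Fintype.card α) #S #A) *
        (∑ j ∈ S, w i j - p * ∑ j, w i j) = bernAvg p univ (fun A =>
          (∑ ρ ∈ H A, (∑ j ∈ (B A).map ρ.toEmbedding, w i j - p * ∑ j, w i j)) / #(H A)) := by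
      have e1 : ∀ A, (∑ ρ ∈ H A, (∑ j ∈ (B A).map ρ.toEmbedding, w i j - p * ∑ j, w i j)) /
          #(H A) = (∑ j ∈ S, w i j - p * ∑ j, w i j) * nestedRatio (Fintype.card α) #S #A +
            ((∑ j, w i j) / Fintype.card α * #A + (-(p * ∑ j, w i j))) := by
        intro A
        rw [sum_sub_distrib, sub_div, hav, hp]
        have := (hH0 A).ne'
        simp only [sum_const, nsmul_eq_mul]
        field_simp
        ring
      rw [bernAvg_congr fun A _ => e1 A, bernAvg_add, bernAvg_add, bernAvg_const,
        bernAvg_const_mul, bernAvg_const_mul, bernAvg_card, card_univ]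
      field_simp
      ring
    rw [e]
    refine bernAvg_mono hp0 hp1 fun A _ => ?_
    exact div_le_div_of_nonneg_right (sum_le_sum fun ρ _ => le_supDev hw _ i) (hH0 A).le
  have hpt : ∀ σ : Equiv.Perm α, Real.exp (θ / 4 * supDev p w (S.map σ.toEmbedding)) ≤
      bernAvg p univ fun A => (∑ ρ ∈ H A,
        Real.exp (θ * supDev p w (((B A).map ρ.toEmbedding).map σ.toEmbedding))) / #(H A) := by
    intro σ
    have h1 := hlin (fun i j => w i (σ j)) (fun i j => hw i _) (fun j => h₀ _)
    simp only [← supDev_map] at h1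
    have h2 := Real.exp_le_exp.2 (mul_le_mul_of_nonneg_left h1 hθ)
    rw [← bernAvg_const_mul] at h2
    refine (le_of_eq ?_).trans (h2.trans ((exp_bernAvg_le hp0 hp1 _).trans
      (bernAvg_mono hp0 hp1 fun A _ => ?_)))
    · congr 1; ring
    · rw [mul_div_assoc', mul_sum]
      exact exp_avg_le (hH A) _
  calc orbitAvg (fun A => Real.exp (θ / 4 * supDev p w A)) S
      ≤ (∑ σ : Equiv.Perm α, bernAvg p univ fun A => (∑ ρ ∈ H A,
        Real.exp (θ * supDev p w (((B A).map ρ.toEmbedding).map σ.toEmbedding))) / #(H A)) /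
          Fintype.card (Equiv.Perm α) :=
        div_le_div_of_nonneg_right (sum_le_sum fun σ _ => hpt σ) (by positivity)
    _ = bernAvg p univ fun A => (∑ ρ ∈ H A,
        orbitAvg (fun C => Real.exp (θ * supDev p w C)) ((B A).map ρ.toEmbedding)) / #(H A) := by
      simp only [bernAvg, orbitAvg]
      rw [sum_comm, sum_div]
      refine sum_congr rfl fun A _ => ?_
      rw [← mul_sum, mul_div_assoc, ← sum_div, ← sum_div, sum_comm, div_right_comm]
    -- After averaging over `σ` only the size of `B A` matters, and it equals that of `A`; the
    -- nested sets disappear.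
    _ = bernAvg p univ (orbitAvg fun C => Real.exp (θ * supDev p w C)) := by
      refine bernAvg_congr fun A _ => ?_
      simp only [orbitAvg_map, sum_const, nsmul_eq_mul]
      rw [mul_div_cancel_left₀ _ (hH0 A).ne']
      exact orbitAvg_eq_of_card_eq _ (hB A)
    _ = _ := bernAvg_orbitAvg _ _

/-- Expected suprema over Bernoulli subsets are controlled by those over a slice. -/
lemma bernAvg_supDev_le (hw : ∀ i j, |w i j| ≤ M) (h₀ : ∀ j, w i₀ j = 0) {S : Finset α}
    (hS : 1 ≤ #S) (hSn : 2 * #S ≤ Fintype.card α) (hp : p = #S / Fintype.card α) {β : ℝ}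
    (hβ : ∀ i, |(∑ j, w i j) / Fintype.card α| ≤ β) {θ : ℝ} (hθ : 0 < θ) :
    θ * bernAvg p univ (supDev p w) ≤
      3 * θ * orbitAvg (supDev p w) S + θ ^ 2 * β ^ 2 * #S / 2 + 1 / 2 := by
  have hn0 : (0 : ℝ) < Fintype.card α := by exact_mod_cast (by omega : 0 < Fintype.card α)
  have hS0 : (0 : ℝ) < #S := by exact_mod_cast hS
  have hSn' : 2 * (#S : ℝ) ≤ Fintype.card α := by exact_mod_cast hSn
  have hp0 : 0 ≤ p := by rw [hp]; positivity
  have hp1 : p ≤ 1 := by rw [hp, div_le_one hn0]; linarith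
  have hpn : p * Fintype.card α = #S := by rw [hp]; field_simp
  have hne : Nonempty ι := ⟨i₀⟩
  have hβ0 : 0 ≤ β := (abs_nonneg _).trans (hβ i₀)
  have hO0 : 0 ≤ orbitAvg (supDev p w) S := by
    have := orbitAvg_mono (A := S) (F := fun _ => 0) fun B _ => supDev_nonneg (p := p) hw h₀ B
    rwa [orbitAvg_const] at this
  have hpt : ∀ A : Finset α, orbitAvg (supDev p w) A ≤
      (2 + (#A : ℝ) / #S) * orbitAvg (supDev p w) S + β * |(#A : ℝ) - #S| := by
    intro A
    obtain ⟨B, hB, hnest⟩ := exists_card_eq_nested (S := A) (card_le_univ S)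
    have hAn : (#A : ℝ) ≤ Fintype.card α := by exact_mod_cast card_le_univ A
    -- deviations over `A` are multiples of averages of deviations over images of `B`
    obtain ⟨H, c, hH, hc0, hc, hav⟩ : ∃ (H : Finset (Equiv.Perm α)) (c : ℝ), H.Nonempty ∧ 0 ≤ c ∧
        c ≤ 2 + (#A : ℝ) / #S ∧ ∀ v : α → ℝ, ∑ j ∈ A, v j - #A / Fintype.card α * ∑ j, v j =
          c * ((∑ ρ ∈ H, (∑ j ∈ B.map ρ.toEmbedding, v j - p * ∑ j, v j)) / #H) := by
      rcases hnest with h | h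
      · have hc := card_le_card h
        have hA0 : (0 : ℝ) < #A := by
          have : 0 < #A := by omega
          positivity
        obtain ⟨H, hH, hav⟩ := exists_stabilizer_avg_subset (S := A) (card_pos.1 (by omega))
        have hH0 : (#H : ℝ) ≠ 0 := by have := card_pos.2 hH; positivity
        refine ⟨H, #A / #S, hH, by positivity, by linarith, fun v => ?_⟩
        rw [sum_sub_distrib, hav B h v, hB, hp]
        simp only [sum_const, nsmul_eq_mul]
        field_simp
      · have hc : (#A : ℝ) ≤ #S := by rw [← hB]; exact_mod_cast card_le_card h
        have hA1 : (0 : ℝ) < Fintype.card α - #A := by linarith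
        have hS1 : (0 : ℝ) < Fintype.card α - #S := by linarith
        obtain ⟨H, hH, hav⟩ := exists_stabilizer_avg_superset (S := A)
          (by exact_mod_cast (by linarith : (#A : ℝ) < Fintype.card α))
        have hH0 : (#H : ℝ) ≠ 0 := by have := card_pos.2 hH; positivity
        refine ⟨H, (Fintype.card α - #A) / (Fintype.card α - #S), hH, by positivity, ?_,
          fun v => ?_⟩
        · have h1 : (Fintype.card α - #A : ℝ) / (Fintype.card α - #S) ≤ 2 := by
            rw [div_le_iff₀ hS1]
            have : (0 : ℝ) ≤ #A := by positivity
            linarith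
          have h2 : (0 : ℝ) ≤ #A / #S := by positivity
          linarith
        · rw [sum_sub_distrib, hav B h v, hB, hp]
          simp only [sum_const, nsmul_eq_mul]
          field_simp
          ring
    have hH0 : (0 : ℝ) < #H := by have := card_pos.2 hH; positivity
    have hpt' : ∀ σ : Equiv.Perm α, supDev p w (A.map σ.toEmbedding) ≤
        c * ((∑ ρ ∈ H, supDev p w ((B.map ρ.toEmbedding).map σ.toEmbedding)) / #H) +
          β * |(#A : ℝ) - #S| := by
      intro σ
      have hmap : ∀ C, supDev p w (C.map σ.toEmbedding) = supDev p (fun i j => w i (σ j)) C :=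
        fun C => supDev_map C σ
      rw [hmap, sum_congr rfl fun ρ _ => hmap _]
      refine ciSup_le fun i => ?_
      have h1 := hav fun j => w i (σ j)
      have h2 : (∑ ρ ∈ H, (∑ j ∈ B.map ρ.toEmbedding, w i (σ j) - p * ∑ j, w i (σ j))) / #H ≤
          (∑ ρ ∈ H, supDev p (fun i j => w i (σ j)) (B.map ρ.toEmbedding)) / #H :=
        div_le_div_of_nonneg_right
          (sum_le_sum fun ρ _ => le_supDev (w := fun i j => w i (σ j)) (fun i j => hw i _) _ i)
          hH0.le
      have h3 := mul_le_mul_of_nonneg_left h2 hc0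
      have h4 : ((#A : ℝ) / Fintype.card α - p) * ∑ j, w i (σ j) ≤ β * |(#A : ℝ) - #S| := by
        rw [Equiv.sum_comp σ (w i)]
        have : ((#A : ℝ) / Fintype.card α - p) * ∑ j, w i j =
          ((∑ j, w i j) / Fintype.card α) * ((#A : ℝ) - #S) := by rw [hp]; field_simp
        rw [this]
        refine (le_abs_self _).trans ?_
        rw [abs_mul]
        exact mul_le_mul_of_nonneg_right (hβ i) (abs_nonneg _)
      linarith
    have hcard : (Fintype.card (Equiv.Perm α) : ℝ) ≠ 0 := by positivity
    calc orbitAvg (supDev p w) A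
        ≤ (∑ σ : Equiv.Perm α, (c * ((∑ ρ ∈ H,
            supDev p w ((B.map ρ.toEmbedding).map σ.toEmbedding)) / #H) +
          β * |(#A : ℝ) - #S|)) / Fintype.card (Equiv.Perm α) :=
          div_le_div_of_nonneg_right (sum_le_sum fun σ _ => hpt' σ) (by positivity)
      _ = c * ((∑ ρ ∈ H, orbitAvg (supDev p w) (B.map ρ.toEmbedding)) / #H) +
          β * |(#A : ℝ) - #S| := by
        simp only [orbitAvg]
        rw [sum_add_distrib, ← mul_sum, ← sum_div, ← sum_div, sum_comm]
        simp only [sum_const, card_univ, nsmul_eq_mul]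
        field_simp
      _ = c * orbitAvg (supDev p w) S + β * |(#A : ℝ) - #S| := by
        simp only [orbitAvg_map, sum_const, nsmul_eq_mul]
        rw [mul_div_cancel_left₀ _ hH0.ne', orbitAvg_eq_of_card_eq _ hB]
      _ ≤ _ := by gcongr
  rw [← bernAvg_orbitAvg, ← bernAvg_const_mul]
  have hpt2 : ∀ A : Finset α, θ * orbitAvg (supDev p w) A ≤
      (2 * θ * orbitAvg (supDev p w) S + 1 / 2) + ((θ * orbitAvg (supDev p w) S / #S) * #A +
        (θ ^ 2 * β ^ 2 / 2) * ((#A : ℝ) - #S) ^ 2) := by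
    intro A
    have h1 := mul_le_mul_of_nonneg_left (hpt A) hθ.le
    -- The change of centering between sizes `#A` and `#S` is split by `ab ≤ (a² + b²)/2`, so that
    -- the variance of `#A`, at most `#S`, bounds it. The mean of `2 + #A / #S` supplies the factor
    -- `3`.
    have h2 : θ * (β * |(#A : ℝ) - #S|) ≤
        1 / 2 + (θ ^ 2 * β ^ 2 / 2) * ((#A : ℝ) - #S) ^ 2 := by
      rw [← sq_abs ((#A : ℝ) - #S)]
      nlinarith [sq_nonneg (θ * β * |(#A : ℝ) - #S| - 1)]
    have h3 : θ * ((2 + (#A : ℝ) / #S) * orbitAvg (supDev p w) S) =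
      2 * θ * orbitAvg (supDev p w) S + (θ * orbitAvg (supDev p w) S / #S) * #A := by ring
    linarith
  refine (bernAvg_mono hp0 hp1 fun A _ => hpt2 A).trans ?_
  have h2 : bernAvg p univ (fun A : Finset α => ((#A : ℝ) - #S) ^ 2) ≤ #S := by
    have := bernAvg_card_sub_sq (p := p) (s := (univ : Finset α))
    rw [card_univ, hpn] at this
    rw [this]
    nlinarith
  rw [bernAvg_add, bernAvg_const, bernAvg_add, bernAvg_const_mul, bernAvg_const_mul, bernAvg_card,
    card_univ, hpn]
  have h3 := mul_le_mul_of_nonneg_left h2 (by positivity : 0 ≤ θ ^ 2 * β ^ 2 / 2)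
  have h4 : θ * orbitAvg (supDev p w) S / #S * #S = θ * orbitAvg (supDev p w) S := by
    field_simp
  linarith

/-- Exponential tail bound for suprema of deviations over a slice. -/
theorem orbitAvg_supDev_tail_le (hw : ∀ i j, |w i j| ≤ M ^ 2) (h₀ : ∀ j, w i₀ j = 0)
    {S : Finset α} (hS : 1 ≤ #S) (hSn : 2 * #S ≤ Fintype.card α)
    (hp : p = #S / Fintype.card α) {r L K y : ℝ} (hr : 0 ≤ r) (hM : 1 ≤ M) (hK : 1 ≤ K)
    (hy : 1 / 2 ≤ y) (hL : (#S : ℝ) ≤ L)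
    (hβ : ∀ i, |(∑ j, w i j) / Fintype.card α| ≤ Real.sqrt (M ^ 2 * r))
    (hV : ∀ A i, ∑ j ∈ A, w i j ^ 2 + p * ∑ j, w i j ^ 2 ≤ M ^ 2 * (4 * L * r + supDev p w A)) :
    orbitAvg (fun A => if 24 * orbitAvg (supDev p w) S + L * r / K + 2176 * K * M ^ 2 * y <
      supDev p w A then 1 else 0) S ≤ Real.exp (-y) := by
  have hn0 : (0 : ℝ) < Fintype.card α := by exact_mod_cast (by omega : 0 < Fintype.card α)
  have hSn' : 2 * (#S : ℝ) ≤ Fintype.card α := by exact_mod_cast hSn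
  have hp0 : 0 ≤ p := by rw [hp]; positivity
  have hp1 : p ≤ 1 / 2 := by rw [hp, div_le_iff₀ hn0]; linarith
  have hM2 : 1 ≤ M ^ 2 := by nlinarith
  have hL0 : 0 ≤ L := le_trans (by positivity) hL
  -- Chernoff's method at parameter `θ/8`: the moment bounds cost `3θE + (16 + 1/2)θ²M²Lr + 1/2`,
  -- and `136 = 8 · 17` makes the `L r / K` part of the threshold worth `17θ²M²Lr`. The last part is
  -- worth `2y`, and `y ≥ 1/2` pays for the `1/2`.
  set θ : ℝ := 1 / (136 * K * M ^ 2) with hθdef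
  have hθ : 0 < θ := by positivity
  have hθM : θ * M ^ 2 = 1 / (136 * K) := by rw [hθdef]; field_simp
  have hθM1 : θ * M ^ 2 ≤ 1 / 136 := by
    rw [hθM]
    exact one_div_le_one_div_of_le (by norm_num) (by linarith)
  set E := orbitAvg (supDev p w) S with hE
  have h1 := orbitAvg_exp_supDev_le hw h₀ hS (by omega) hp (θ := θ / 2) (by positivity)
  have h2 := bernAvg_exp_supDev_le hp0 hp1 hw h₀ hθ (by linarith) (by linarith) hV
  have h3 := bernAvg_supDev_le hw h₀ hS hSn hp hβ hθ
  rw [Real.sq_sqrt (by positivity)] at h3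
  set T := 24 * E + L * r / K + 2176 * K * M ^ 2 * y with hT
  have h4 : orbitAvg (fun A => if T < supDev p w A then 1 else 0) S ≤
      orbitAvg (fun A => Real.exp (-(θ / 8 * T)) * Real.exp (θ / 2 / 4 * supDev p w A)) S := by
    refine orbitAvg_mono fun A _ => ?_
    rw [← Real.exp_add]
    split_ifs with h
    · refine Real.one_le_exp ?_
      nlinarith
    · positivity
  rw [orbitAvg_const_mul] at h4
  refine h4.trans ((mul_le_mul_of_nonneg_left (h1.trans h2) (Real.exp_pos _).le).trans ?_)
  rw [← Real.exp_add, Real.exp_le_exp]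
  have h5 : θ / 8 * T = 3 * θ * E + 17 * (θ ^ 2 * M ^ 2) * (L * r) + 2 * y := by
    rw [hT, hθdef]; field_simp; ring
  have h6 : θ ^ 2 * (M ^ 2 * r) * #S ≤ (θ ^ 2 * M ^ 2) * (L * r) := by
    have : θ ^ 2 * (M ^ 2 * r) * #S ≤ θ ^ 2 * (M ^ 2 * r) * L := by gcongr
    linarith
  have h7 : 0 ≤ (θ ^ 2 * M ^ 2) * (L * r) := by positivity
  linarith

end SupDev

/-! ### Deviations of averages over a slice -/

section MeanDev

variable {α ι : Type*} [Fintype α]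

/-- The deviation of the average of `v` over `A` from its average over all points. -/
def meanDev (A : Finset α) (v : α → ℝ) : ℝ :=
  (∑ j ∈ A, v j) / #A - (∑ j, v j) / Fintype.card α

variable {v : ι → α → ℝ} {M : ℝ}

lemma sum_sub_eq_card_mul_meanDev {A S : Finset α} (hA : #A = #S) (hS : 1 ≤ #S) (v : α → ℝ) :
    ∑ j ∈ A, v j - (#S : ℝ) / Fintype.card α * ∑ j, v j = #S * meanDev A v := by
  have hS0 : (#S : ℝ) ≠ 0 := by positivity
  rw [meanDev, hA]
  field_simp

lemma supDev_eq_card_mul_iSup {A S : Finset α} (hA : #A = #S) (hS : 1 ≤ #S) :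
    supDev ((#S : ℝ) / Fintype.card α) v A = #S * ⨆ i, meanDev A (v i) := by
  rw [supDev, Real.mul_iSup_of_nonneg (by positivity)]
  simp only [sum_sub_eq_card_mul_meanDev hA hS]

lemma abs_mean_le_sqrt {v : α → ℝ} {r : ℝ} (hr : (∑ j, v j ^ 2) / Fintype.card α ≤ r)
    (hn : 0 < Fintype.card α) : |(∑ j, v j) / Fintype.card α| ≤ Real.sqrt r := by
  refine Real.abs_le_sqrt (le_trans ?_ hr)
  have h := sq_sum_le_card_mul_sum_sq (s := (univ : Finset α)) (f := v)
  rw [card_univ] at h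
  have hn' : (0 : ℝ) < Fintype.card α := by exact_mod_cast hn
  rw [div_pow, div_le_div_iff₀ (by positivity) hn']
  nlinarith

variable [DecidableEq α]

/-- Tail bound for the largest deviation of an average over at most half of the points. -/
lemma orbitAvg_iSup_meanDev_tail_le_of_small (hv : ∀ i j, |v i j| ≤ M) {i₀ : ι}
    (h₀ : ∀ j, v i₀ j = 0) {S : Finset α} (hS : 1 ≤ #S) (hSn : 2 * #S ≤ Fintype.card α)
    {r K y ψ : ℝ} (hT : ∀ i, (∑ j, v i j ^ 2) / Fintype.card α ≤ r) (hM : 1 ≤ M) (hK : 1 ≤ K)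
    (hy : 1 / 2 ≤ y) (h1 : orbitAvg (fun A => ⨆ i, meanDev A (v i)) S ≤ ψ)
    (h2 : orbitAvg (fun A => ⨆ i, meanDev A (v i ^ 2)) S ≤ ψ) :
    orbitAvg (fun A => if 48 * ψ + r / K + 2176 * K * M ^ 2 * y / #S <
      ⨆ i, meanDev A (v i) then 1 else 0) S ≤ Real.exp (-y) := by
  have hn0 : (0 : ℝ) < Fintype.card α := by exact_mod_cast (by omega : 0 < Fintype.card α)
  have hS0 : (0 : ℝ) < #S := by exact_mod_cast hS
  have hM2 : 1 ≤ M ^ 2 := by nlinarith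
  have hne : Nonempty ι := ⟨i₀⟩
  set p : ℝ := (#S : ℝ) / Fintype.card α with hp
  have hp0 : 0 ≤ p := by positivity
  have hr : 0 ≤ r := by simpa [h₀] using hT i₀
  have hv2 : ∀ i j, v i j ^ 2 ≤ M ^ 2 := fun i j => by
    rw [← sq_abs]; exact pow_le_pow_left₀ (abs_nonneg _) (hv i j) 2
  -- With the squares adjoined, `∑ j ∈ A, v i j ^ 2` exceeds its expected value by at most the
  -- enlarged supremum, as the self-bounding hypothesis requires. The price is the doubled mean
  -- `2ψ`, whence `48 = 2 · 24`.
  set w : ι ⊕ ι → α → ℝ := Sum.elim v fun i => v i ^ 2 with hw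
  have hwM : ∀ i j, |w i j| ≤ M ^ 2 := by
    rintro (i | i) j
    · exact (hv i j).trans (by nlinarith)
    · simpa [hw] using hv2 i j
  have hv2M : ∀ i j, |(v i ^ 2) j| ≤ M ^ 2 := fun i j => hwM (Sum.inr i) j
  have hw₀ : ∀ j, w (Sum.inl i₀) j = 0 := h₀
  have hlo : ∀ A, supDev p v A ≤ supDev p w A := fun A =>
    ciSup_le fun i => le_supDev hwM A (Sum.inl i)
  have hlo2 : ∀ A, supDev p (fun i => v i ^ 2) A ≤ supDev p w A := fun A =>
    ciSup_le fun i => le_supDev hwM A (Sum.inr i)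
  have hup : ∀ A, supDev p w A ≤ supDev p v A + supDev p (fun i => v i ^ 2) A := by
    intro A
    have e1 := supDev_nonneg (p := p) hv h₀ A
    have e2 := supDev_nonneg (p := p) hv2M (i₀ := i₀) (fun j => by simp [h₀]) A
    refine ciSup_le ?_
    rintro (i | i)
    · have := le_supDev (p := p) hv A i
      simp only [hw, Sum.elim_inl]; linarith
    · have := le_supDev (p := p) hv2M A i
      simp only [hw, Sum.elim_inr]; linarith
  have hE : orbitAvg (supDev p w) S ≤ #S * (2 * ψ) := by
    refine (orbitAvg_mono (G := fun A => #S * ((⨆ i, meanDev A (v i)) +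
      ⨆ i, meanDev A (v i ^ 2))) fun A hA => ?_).trans ?_
    · refine (hup A).trans_eq ?_
      rw [hp, supDev_eq_card_mul_iSup hA hS, supDev_eq_card_mul_iSup hA hS]
      ring
    · rw [orbitAvg_const_mul, orbitAvg_add]
      exact mul_le_mul_of_nonneg_left (by linarith) hS0.le
  have hpT : ∀ i, p * ∑ j, v i j ^ 2 ≤ #S * r := fun i => by
    have := mul_le_mul_of_nonneg_left (hT i) hS0.le
    rw [hp]
    refine le_of_eq_of_le ?_ this
    ring
  have hVinl : ∀ A i, ∑ j ∈ A, v i j ^ 2 + p * ∑ j, v i j ^ 2 ≤ 4 * #S * r + supDev p w A := by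
    intro A i
    have e1 := (le_supDev (p := p) hv2M A i).trans (hlo2 A)
    have e2 := hpT i
    simp only [Pi.pow_apply] at e1
    have : 0 ≤ #S * r := by positivity
    linarith
  have hVnn : ∀ A, 0 ≤ 4 * #S * r + supDev p w A := fun A => by
    have := supDev_nonneg (p := p) hwM hw₀ A
    positivity
  have key := orbitAvg_supDev_tail_le hwM hw₀ hS hSn hp hr hM hK hy le_rfl ?_ ?_
  · refine le_trans (orbitAvg_mono fun A hA => ?_) key
    split_ifs with ha hb hb
    · exact le_rfl
    · refine absurd (lt_of_le_of_lt ?_ (lt_of_lt_of_le (mul_lt_mul_of_pos_left ha hS0)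
        ((supDev_eq_card_mul_iSup hA hS).symm.le.trans (hlo A)))) hb
      have : (#S : ℝ) * (48 * ψ + r / K + 2176 * K * M ^ 2 * y / #S) =
        24 * (#S * (2 * ψ)) + #S * r / K + 2176 * K * M ^ 2 * y := by field_simp; ring
      rw [this]
      linarith
    · exact zero_le_one
    · exact le_rfl
  · rintro (i | i)
    · exact (abs_mean_le_sqrt (hT i) (by omega)).trans (Real.sqrt_le_sqrt (by nlinarith))
    · refine Real.abs_le_sqrt ?_
      have e1 := hT i
      have e0 : 0 ≤ (∑ j, v i j ^ 2) / Fintype.card α := by positivity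
      have e2 : (∑ j, v i j ^ 2) / Fintype.card α ≤ M ^ 2 := by
        rw [div_le_iff₀ hn0]
        refine (sum_le_sum fun j _ => hv2 i j).trans_eq ?_
        simp [mul_comm]
      simp only [hw, Sum.elim_inr, Pi.pow_apply]
      rw [sq]
      exact mul_le_mul e2 e1 e0 (by positivity)
  · rintro A (i | i)
    · refine (hVinl A i).trans ?_
      have := hVnn A
      simp only [hw] at *
      nlinarith
    · refine le_trans ?_ (mul_le_mul_of_nonneg_left (hVinl A i) (by positivity : 0 ≤ M ^ 2))
      have e : ∀ j, w (Sum.inr i) j ^ 2 ≤ M ^ 2 * v i j ^ 2 := fun j => by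
        simp only [hw, Sum.elim_inr, Pi.pow_apply]
        rw [sq (v i j ^ 2)]
        exact mul_le_mul_of_nonneg_right (hv2 i j) (by positivity)
      have e' : ∀ C : Finset α, ∑ j ∈ C, w (Sum.inr i) j ^ 2 ≤ M ^ 2 * ∑ j ∈ C, v i j ^ 2 :=
        fun C => by rw [mul_sum]; exact sum_le_sum fun j _ => e j
      have e1 := e' A
      have e2 := mul_le_mul_of_nonneg_left (e' univ) hp0
      linarith

/-- Tail bound for the largest deviation of an average over at least half of the points. -/
lemma orbitAvg_iSup_meanDev_tail_le_of_large (hv : ∀ i j, |v i j| ≤ M) {i₀ : ι}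
    (h₀ : ∀ j, v i₀ j = 0) {S : Finset α} (hS : #S < Fintype.card α)
    (hSn : Fintype.card α ≤ 2 * #S)
    {r K y ψ : ℝ} (hT : ∀ i, (∑ j, v i j ^ 2) / Fintype.card α ≤ r) (hM : 1 ≤ M) (hK : 1 ≤ K)
    (hy : 1 / 2 ≤ y) (h1 : orbitAvg (fun A => ⨆ i, meanDev A (v i)) S ≤ ψ) :
    orbitAvg (fun A => if 48 * ψ + r / K + 2176 * K * M ^ 2 * y / #S <
      ⨆ i, meanDev A (v i) then 1 else 0) S ≤ Real.exp (-y) := by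
  have hn0 : (0 : ℝ) < Fintype.card α := by exact_mod_cast (by omega : 0 < Fintype.card α)
  have hS0 : (0 : ℝ) < #S := by exact_mod_cast (by omega : 0 < #S)
  have hM2 : 1 ≤ M ^ 2 := by nlinarith
  have hne : Nonempty ι := ⟨i₀⟩
  have hr : 0 ≤ r := by simpa [h₀] using hT i₀
  have hScN : #Sᶜ = Fintype.card α - #S := card_compl S
  have hSc : (#Sᶜ : ℝ) = Fintype.card α - #S := by rw [hScN, Nat.cast_sub hS.le]
  set p : ℝ := (#Sᶜ : ℝ) / Fintype.card α with hp
  have hp0 : 0 ≤ p := by positivity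
  have hp1 : p ≤ 1 := by rw [hp, hSc, div_le_one hn0]; linarith
  -- Deviations of `v` over `A` are deviations of `-v` over the complement, which has at most half
  -- of the points. No squares are needed: the whole sum of squares is at most `2 #S r`, a
  -- deterministic variance bound on the scale `L = #S`.
  set w : ι → α → ℝ := fun i => -v i with hw
  have hwM : ∀ i j, |w i j| ≤ M ^ 2 := fun i j => by
    simp only [hw, Pi.neg_apply, abs_neg]; exact (hv i j).trans (by nlinarith)
  have hw₀ : ∀ j, w i₀ j = 0 := fun j => by simp [hw, h₀]
  have heq : ∀ A, #A = #S → supDev p w Aᶜ = #S * ⨆ i, meanDev A (v i) := by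
    intro A hA
    rw [← supDev_eq_card_mul_iSup hA (by omega), supDev, supDev]
    congr 1
    ext i
    have e := sum_compl_add_sum A (v i)
    have e2 : p = 1 - (#S : ℝ) / Fintype.card α := by rw [hp, hSc]; field_simp
    simp only [hw, Pi.neg_apply, sum_neg_distrib]
    rw [e2]
    linear_combination -e
  have hE : orbitAvg (supDev p w) Sᶜ ≤ #S * ψ := by
    rw [← orbitAvg_compl]
    refine (orbitAvg_mono fun A hA => (heq A hA).le).trans ?_
    rw [orbitAvg_const_mul]
    exact mul_le_mul_of_nonneg_left h1 hS0.le
  have hψ0 : 0 ≤ ψ := by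
    have e1 := orbitAvg_mono (A := Sᶜ) (F := fun _ => 0) fun B _ =>
      supDev_nonneg (p := p) hwM hw₀ B
    rw [orbitAvg_const] at e1
    exact nonneg_of_mul_nonneg_right (e1.trans hE) hS0
  have hle : (#Sᶜ : ℝ) ≤ #S := by
    exact_mod_cast (by omega : #Sᶜ ≤ #S)
  have hT' : ∀ i, ∑ j, v i j ^ 2 ≤ 2 * #S * r := fun i => by
    have e1 := (div_le_iff₀ hn0).1 (hT i)
    have e2 : (Fintype.card α : ℝ) ≤ 2 * #S := by exact_mod_cast hSn
    nlinarith
  have key := orbitAvg_supDev_tail_le hwM hw₀ (S := Sᶜ) (by omega) (by omega) hp hr hM hK hy hle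
    ?_ ?_
  · rw [← orbitAvg_compl] at key
    refine le_trans (orbitAvg_mono fun A hA => ?_) key
    split_ifs with ha hb hb
    · exact le_rfl
    · refine absurd (lt_of_le_of_lt ?_ (lt_of_lt_of_le (mul_lt_mul_of_pos_left ha hS0)
        (heq A hA).symm.le)) hb
      have : (#S : ℝ) * (48 * ψ + r / K + 2176 * K * M ^ 2 * y / #S) =
        48 * (#S * ψ) + #S * r / K + 2176 * K * M ^ 2 * y := by field_simp
      rw [this]
      have : 0 ≤ #S * ψ := by positivity
      linarith
    · exact zero_le_one
    · exact le_rfl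
  · intro i
    simp only [hw, Pi.neg_apply, sum_neg_distrib, neg_div, abs_neg]
    exact (abs_mean_le_sqrt (hT i) (by omega)).trans (Real.sqrt_le_sqrt (by nlinarith))
  · intro A i
    have e1 := supDev_nonneg (p := p) hwM hw₀ A
    have e2 : ∑ j ∈ A, v i j ^ 2 ≤ ∑ j, v i j ^ 2 :=
      sum_le_sum_of_subset_of_nonneg (subset_univ A) fun _ _ _ => by positivity
    have e3 : p * ∑ j, v i j ^ 2 ≤ ∑ j, v i j ^ 2 :=
      mul_le_of_le_one_left (by positivity) hp1
    have e4 := hT' i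
    simp only [hw, Pi.neg_apply, neg_sq] at *
    have e5 : 0 ≤ #S * r := by positivity
    nlinarith

/-- Tail bound for the largest deviation of an average over a slice. The bound on the squares is
only needed for small slices. -/
theorem orbitAvg_iSup_meanDev_tail_le (hv : ∀ i j, |v i j| ≤ M) {i₀ : ι}
    (h₀ : ∀ j, v i₀ j = 0) {S : Finset α} (hS : 1 ≤ #S) (hSn : #S < Fintype.card α)
    {r K y ψ : ℝ} (hT : ∀ i, (∑ j, v i j ^ 2) / Fintype.card α ≤ r) (hM : 1 ≤ M) (hK : 1 ≤ K)
    (hy : 1 / 2 ≤ y) (h1 : orbitAvg (fun A => ⨆ i, meanDev A (v i)) S ≤ ψ)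
    (h2 : 2 * #S < Fintype.card α → orbitAvg (fun A => ⨆ i, meanDev A (v i ^ 2)) S ≤ ψ) :
    orbitAvg (fun A => if 48 * ψ + r / K + 2176 * K * M ^ 2 * y / #S <
      ⨆ i, meanDev A (v i) then 1 else 0) S ≤ Real.exp (-y) := by
  -- Ties go to the large case: when `m = u`, squares are controlled for the test set only, and the
  -- training set must do without them.
  rcases lt_or_ge (2 * #S) (Fintype.card α) with h | h
  · exact orbitAvg_iSup_meanDev_tail_le_of_small hv h₀ hS h.le hT hM hK hy h1 (h2 h)
  · exact orbitAvg_iSup_meanDev_tail_le_of_large hv h₀ hSn h hT hM hK hy h1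

end MeanDev

/-! ### The law of the test set -/

section DrawLaw

variable {m u : ℕ}

lemma permState_succ (d : Draw m u) {k : ℕ} (hk : k < u) :
    permState d (k + 1) =
      permState d k * Equiv.swap ⟨k, lt_of_lt_of_le hk (Nat.le_add_left u m)⟩ (d ⟨k, hk⟩).1 := by
  rw [permState, dif_pos hk]

/-- The swap of step `k` only touches positions at least `k`, so an output stays where it was
placed. -/
lemma permState_apply_of_lt (d : Draw m u) (i : Fin u) {k : ℕ} (hik : (i : ℕ) < k) (hk : k ≤ u) :
    permState d k ⟨i, lt_of_lt_of_le i.2 (Nat.le_add_left u m)⟩ = testIndex d i := by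
  induction k, hik using Nat.le_induction with
  | base =>
    rw [permState_succ d i.2, Equiv.Perm.mul_apply, Equiv.swap_apply_left]
    rfl
  | succ k hik ih =>
    rw [permState_succ d hk, Equiv.Perm.mul_apply, Equiv.swap_apply_of_ne_of_ne, ih (by omega)]
    · simp only [ne_eq, Fin.mk.injEq]; omega
    · have := (d ⟨k, hk⟩).2
      intro h
      rw [← h] at this
      simp only at this
      omega

lemma testIndex_injective (d : Draw m u) : Function.Injective (testIndex d) := by
  intro i j hij
  rw [← permState_apply_of_lt d i i.2 le_rfl, ← permState_apply_of_lt d j j.2 le_rfl] at hij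
  simpa [Fin.ext_iff] using (permState d u).injective hij

lemma card_testSet (d : Draw m u) : #(testSet d) = u := by
  rw [testSet, card_image_of_injective _ (testIndex_injective d), card_univ, Fintype.card_fin]

lemma card_trainSet (d : Draw m u) : #(trainSet d) = m := by
  rw [trainSet, card_compl, card_testSet, Fintype.card_fin]; omega

lemma permState_congr {d d' : Draw m u} {k : ℕ} (h : ∀ i : Fin u, (i : ℕ) < k → d i = d' i) :
    permState d k = permState d' k := by
  induction k with
  | zero => rfl
  | succ k ih =>
    have h1 := ih fun i hi => h i (by omega)
    by_cases hk : k < u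
    · rw [permState_succ d hk, permState_succ d' hk, h1, h ⟨k, hk⟩ (Nat.lt_succ_self k)]
    · rw [permState, permState, dif_neg hk, dif_neg hk, h1]

/-- The outputs of RANDPERM as an embedding of the steps into the points. -/
def testEmbedding (d : Draw m u) : Fin u ↪ Fin (m + u) :=
  ⟨testIndex d, testIndex_injective d⟩

/-- Earlier coordinates determine the array before step `i`; that array is a permutation, so the
output of step `i` determines `d i`. -/
lemma testEmbedding_injective :
    Function.Injective (testEmbedding : Draw m u → (Fin u ↪ Fin (m + u))) := by
  intro d d' h
  have h1 : ∀ i, testIndex d i = testIndex d' i := fun i => DFunLike.congr_fun h i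
  suffices h2 : ∀ k, ∀ i : Fin u, (i : ℕ) = k → d i = d' i from funext fun i => h2 i i rfl
  intro k
  induction k using Nat.strong_induction_on with
  | _ k ih =>
    intro i hi
    have h3 : permState d i = permState d' i := permState_congr fun j hj => ih j (by omega) j rfl
    have h4 := h1 i
    rw [testIndex, testIndex, h3] at h4
    exact Subtype.ext ((permState d' i).injective h4)

lemma testEmbedding_bijective :
    Function.Bijective (testEmbedding : Draw m u → (Fin u ↪ Fin (m + u))) := by
  rw [Fintype.bijective_iff_injective_and_card]
  refine ⟨testEmbedding_injective, ?_⟩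
  rw [Fintype.card_embedding_eq, Fintype.card_fin, Fintype.card_fin, Fintype.card_pi,
    Nat.descFactorial_eq_prod_range, ← Fin.prod_univ_eq_prod_range]
  refine prod_congr rfl fun i _ => ?_
  rw [Fintype.card_subtype]
  have : (univ.filter fun j : Fin (m + u) => (i : ℕ) ≤ j) =
      Ici ⟨i, lt_of_lt_of_le i.2 (Nat.le_add_left u m)⟩ := by
    ext j; simp [Fin.le_def]
  rw [this, Fin.card_Ici]

/-- Draws correspond bijectively to injections of the steps into the points, and relabelling the
points permutes these injections; hence the test set is uniform among sets of size `u`. -/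
lemma sum_testSet_eq (F : Finset (Fin (m + u)) → ℝ) {S : Finset (Fin (m + u))} (hS : #S = u) :
    ∑ d : Draw m u, F (testSet d) = Fintype.card (Draw m u) * orbitAvg F S := by
  have h1 : ∑ d : Draw m u, F (testSet d) = ∑ e : Fin u ↪ Fin (m + u), F (univ.map e) :=
    Fintype.sum_bijective _ testEmbedding_bijective _ _ fun d => by
      rw [testSet, map_eq_image]; rfl
  have h2 : ∀ σ : Equiv.Perm (Fin (m + u)), ∑ e : Fin u ↪ Fin (m + u), F (univ.map e) =
      ∑ e : Fin u ↪ Fin (m + u), F ((univ.map e).map σ.toEmbedding) := fun σ =>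
    Fintype.sum_equiv (Equiv.embeddingCongr (Equiv.refl _) σ.symm) _ _ fun e => by
      rw [map_map]
      congr 2
      ext i
      simp
  have hc : (Fintype.card (Equiv.Perm (Fin (m + u))) : ℝ) ≠ 0 := by positivity
  rw [h1]
  calc ∑ e : Fin u ↪ Fin (m + u), F (univ.map e)
      = (∑ σ : Equiv.Perm (Fin (m + u)), ∑ e : Fin u ↪ Fin (m + u),
          F ((univ.map e).map σ.toEmbedding)) / Fintype.card (Equiv.Perm (Fin (m + u))) := by
        rw [← sum_congr rfl fun σ _ => h2 σ]
        simp only [sum_const, card_univ, nsmul_eq_mul]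
        field_simp
    _ = ∑ e : Fin u ↪ Fin (m + u), orbitAvg F (univ.map e) := by
        rw [sum_comm, sum_div]; rfl
    _ = _ := by
        rw [sum_congr rfl fun e _ => orbitAvg_eq_of_card_eq F (B := S) (by simp [hS])]
        rw [sum_const, card_univ, nsmul_eq_mul, ← Fintype.card_of_bijective testEmbedding_bijective]

instance (m u : ℕ) (i : Fin u) : Nonempty {j : Fin (m + u) // (i : ℕ) ≤ (j : ℕ)} :=
  ⟨⟨⟨i, lt_of_lt_of_le i.2 (Nat.le_add_left u m)⟩, le_rfl⟩⟩

instance (m u : ℕ) : IsProbabilityMeasure (drawLaw m u) := by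
  unfold drawLaw
  have : ∀ i : Fin u, IsProbabilityMeasure (ProbabilityTheory.uniformOn
      (Set.univ : Set {j : Fin (m + u) // (i : ℕ) ≤ (j : ℕ)})) := fun i =>
    ProbabilityTheory.isProbabilityMeasure_uniformOn Set.finite_univ Set.univ_nonempty
  infer_instance

lemma integral_drawLaw (F : Draw m u → ℝ) :
    ∫ d, F d ∂(drawLaw m u) = (∑ d, F d) / Fintype.card (Draw m u) := by
  have hp : ∀ i : Fin u, IsProbabilityMeasure (ProbabilityTheory.uniformOn
      (Set.univ : Set {j : Fin (m + u) // (i : ℕ) ≤ (j : ℕ)})) := fun i =>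
    ProbabilityTheory.isProbabilityMeasure_uniformOn Set.finite_univ Set.univ_nonempty
  have hκ : ∃ κ : ℝ, ∀ d : Draw m u, (drawLaw m u).real {d} = κ := by
    refine ⟨∏ i : Fin u, ((1 : ENNReal) / Fintype.card {j : Fin (m + u) // (i : ℕ) ≤ (j : ℕ)}).toReal,
      fun d => ?_⟩
    rw [measureReal_def, drawLaw, Measure.pi_singleton, ENNReal.toReal_prod]
    refine prod_congr rfl fun i _ => ?_
    rw [ProbabilityTheory.uniformOn_univ, Measure.count_singleton]
  obtain ⟨κ, hκ⟩ := hκ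
  have hint : ∀ F : Draw m u → ℝ, ∫ d, F d ∂(drawLaw m u) = κ * ∑ d, F d := fun F => by
    rw [integral_fintype Integrable.of_finite]
    simp only [hκ, smul_eq_mul, mul_sum]
  have h1 := hint fun _ => 1
  simp only [integral_const, probReal_univ, smul_eq_mul, mul_one, sum_const, card_univ,
    nsmul_eq_mul] at h1
  have hc : (Fintype.card (Draw m u) : ℝ) ≠ 0 := by
    intro h
    rw [h, mul_zero] at h1
    exact one_ne_zero h1
  rw [hint F, eq_div_iff hc]
  linear_combination -(∑ d, F d) * h1

lemma integral_testSet (F : Finset (Fin (m + u)) → ℝ) {S : Finset (Fin (m + u))} (hS : #S = u) :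
    ∫ d, F (testSet d) ∂(drawLaw m u) = orbitAvg F S := by
  have hc : (Fintype.card (Draw m u) : ℝ) ≠ 0 := by
    have : Nonempty (Draw m u) := ⟨fun i => Classical.arbitrary _⟩
    have : 0 < Fintype.card (Draw m u) := Fintype.card_pos
    positivity
  rw [integral_drawLaw, sum_testSet_eq F hS]
  field_simp

lemma integral_trainSet (F : Finset (Fin (m + u)) → ℝ) {S : Finset (Fin (m + u))} (hS : #S = m) :
    ∫ d, F (trainSet d) ∂(drawLaw m u) = orbitAvg F S := by
  have h := integral_testSet (fun A => F Aᶜ) (S := Sᶜ)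
    (by rw [card_compl, hS, Fintype.card_fin]; omega)
  rw [orbitAvg_compl, compl_compl] at h
  exact h

end DrawLaw

/-! ### Sub-root functions -/

/-- A Tarski argument that avoids continuity: the supremum of `{t | t ≤ ψ t}`, finite because `ψ`
grows at most like a square root, is a fixed point by monotonicity. If `ψ s > s`, this fixed point
would be at least `s > q`, against maximality of `q`. -/
lemma IsSubRoot.le_of_fixedPoint_lt {ψ : ℝ → ℝ} (hψ : IsSubRoot ψ) {q s : ℝ}
    (hq : IsFixedPointOf ψ q) (hs : q < s) : ψ s ≤ s := by
  by_contra! hlt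
  have hs0 : 0 < s := hq.1.1.trans_lt hs
  set T : Set ℝ := {t | 0 ≤ t ∧ t ≤ ψ t} with hT
  have hsT : s ∈ T := ⟨hs0.le, hlt.le⟩
  have hbdd : BddAbove T := by
    refine ⟨max s ((ψ s / Real.sqrt s) ^ 2), fun t ht => ?_⟩
    rcases le_total t s with h | h
    · exact h.trans (le_max_left _ _)
    · refine le_trans ?_ (le_max_right _ _)
      have ht0 : 0 < t := hs0.trans_le h
      have h1 : ψ t / Real.sqrt t ≤ ψ s / Real.sqrt s := hψ.anti hs0 ht0 h
      have h2 : Real.sqrt t ≤ ψ t / Real.sqrt t := by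
        rw [le_div_iff₀ (Real.sqrt_pos.2 ht0), Real.mul_self_sqrt ht0.le]
        exact ht.2
      calc t = Real.sqrt t ^ 2 := (Real.sq_sqrt ht0.le).symm
        _ ≤ _ := pow_le_pow_left₀ (Real.sqrt_nonneg _) (h2.trans h1) 2
  set τ := sSup T with hτ
  have hsτ : s ≤ τ := le_csSup hbdd hsT
  have hτ0 : 0 ≤ τ := hs0.le.trans hsτ
  have h1 : τ ≤ ψ τ := csSup_le ⟨s, hsT⟩ fun t ht =>
    ht.2.trans (hψ.mono ht.1 hτ0 (le_csSup hbdd ht))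
  have h2 : ψ τ ≤ τ :=
    le_csSup hbdd ⟨hψ.nonneg τ hτ0, hψ.mono hτ0 (hψ.nonneg τ hτ0) h1⟩
  have h3 := hq.2 ⟨hτ0, le_antisymm h2 h1⟩
  linarith

/-- Here `ψ r ≤ √s √r`, and `48 √s √r ≤ r/K + 576 K s` by completing the square. Taking `s` strictly
above the fixed point avoids dividing by `√0`. -/
lemma IsSubRoot.const_mul_le {ψ : ℝ → ℝ} (hψ : IsSubRoot ψ) {q s r K : ℝ}
    (hq : IsFixedPointOf ψ q) (hs : q < s) (hsr : s ≤ r) (hK : 1 ≤ K) :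
    48 * ψ r ≤ r / K + 576 * K * s := by
  have hs0 : 0 < s := hq.1.1.trans_lt hs
  have hr0 : 0 < r := hs0.trans_le hsr
  have h1 : ψ r / Real.sqrt r ≤ ψ s / Real.sqrt s := hψ.anti hs0 hr0 hsr
  have h2 : ψ s / Real.sqrt s ≤ Real.sqrt s := by
    rw [div_le_iff₀ (Real.sqrt_pos.2 hs0), Real.mul_self_sqrt hs0.le]
    exact hψ.le_of_fixedPoint_lt hq hs
  have h3 := (div_le_iff₀ (Real.sqrt_pos.2 hr0)).1 (h1.trans h2)
  have hK0 : 0 < K := by linarith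
  have h4 : r / K + 576 * K * s - 48 * (Real.sqrt s * Real.sqrt r) =
      (Real.sqrt r - 24 * K * Real.sqrt s) ^ 2 / K := by
    have e1 := Real.sq_sqrt hr0.le
    have e2 := Real.sq_sqrt hs0.le
    field_simp
    linear_combination -e1 - 576 * K ^ 2 * e2
  have h5 : 0 ≤ (Real.sqrt r - 24 * K * Real.sqrt s) ^ 2 / K := by positivity
  linarith

/-! ### Uniform deviation bounds for a fixed class -/

section Tail

variable {X Y : Type*} {m u : ℕ} {z : Fin (m + u) → X × Y}

lemma testDev_eq_meanDev (d : Draw m u) (h : X × Y → ℝ) :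
    testDev z d h = meanDev (testSet d) fun j => h (z j) := by
  simp [testDev, testAvg, fullAvg, meanDev, card_testSet]

lemma trainDev_eq_meanDev (d : Draw m u) (h : X × Y → ℝ) :
    trainDev z d h = meanDev (trainSet d) fun j => h (z j) := by
  simp [trainDev, trainAvg, fullAvg, meanDev, card_trainSet]

lemma meanDev_const_mul {α : Type*} [Fintype α] (A : Finset α) (s : ℝ) (v : α → ℝ) :
    meanDev A (fun j => s * v j) = s * meanDev A v := by
  simp only [meanDev, ← mul_sum]
  ring

/-- A uniformly distributed random set of points of fixed size. -/
structure IsUniformSet (A : Draw m u → Finset (Fin (m + u))) (k : ℕ) : Prop where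
  card : ∀ d, #(A d) = k
  integral : ∀ (F : Finset (Fin (m + u)) → ℝ) (S : Finset (Fin (m + u))), #S = k →
    ∫ d, F (A d) ∂(drawLaw m u) = orbitAvg F S

lemma isUniformSet_testSet : IsUniformSet (m := m) (u := u) testSet u :=
  ⟨card_testSet, fun F _ hS => integral_testSet F hS⟩

lemma isUniformSet_trainSet : IsUniformSet (m := m) (u := u) trainSet m :=
  ⟨card_trainSet, fun F _ hS => integral_trainSet F hS⟩

variable {A : Draw m u → Finset (Fin (m + u))} {k : ℕ} {H : Set (X × Y → ℝ)} {M r K y : ℝ}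

/-- The slice tail bound as a statement about draws. The sign `s` covers `R⁺` and `R⁻` at once; the
squares do not see it. -/
theorem IsUniformSet.measureReal_tail_le (hA : IsUniformSet A k) (hk : 1 ≤ k) (hkn : k < m + u)
    (h₀ : 0 ∈ H) (hM : 1 ≤ M) (hH : ∀ h ∈ H, ∀ i, |h (z i)| ≤ M) (hT : ∀ h ∈ H, avgSq z h ≤ r)
    (hK : 1 ≤ K) (hy : 1 / 2 ≤ y) {s ψ : ℝ} (hs : s ^ 2 = 1)
    (h1 : expSup H (fun d h => s * meanDev (A d) fun j => h (z j)) ≤ ψ)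
    (h2 : 2 * k < m + u → expSup H (fun d h => meanDev (A d) fun j => (h ^ 2) (z j)) ≤ ψ) :
    (drawLaw m u).real {d | ¬ ∀ h ∈ H, s * meanDev (A d) (fun j => h (z j)) ≤
      48 * ψ + r / K + 2176 * K * M ^ 2 * y / k} ≤ Real.exp (-y) := by
  obtain ⟨S, -, hS⟩ := exists_subset_card_eq (s := (univ : Finset (Fin (m + u)))) (n := k)
    (by simpa using hkn.le)
  set v : H → Fin (m + u) → ℝ := fun h j => s * h.1 (z j) with hv
  have hs1 : |s| = 1 := by
    rw [← sq_abs] at hs; nlinarith [abs_nonneg s]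
  have hvM : ∀ i j, |v i j| ≤ M := fun i j => by
    rw [hv, abs_mul, hs1, one_mul]; exact hH _ i.2 j
  have hv2 : ∀ i j, v i j ^ 2 = (i.1 ^ 2) (z j) := fun i j => by
    simp [hv, mul_pow, hs]
  have e1 : ∀ B : Finset (Fin (m + u)), ⨆ i, meanDev B (v i) =
      sSup ((fun h : X × Y → ℝ => s * meanDev B fun j => h (z j)) '' H) := fun B => by
    rw [sSup_image']
    simp only [hv, meanDev_const_mul]
  have e2 : ∀ B : Finset (Fin (m + u)), ⨆ i, meanDev B (v i ^ 2) =
      sSup ((fun h : X × Y → ℝ => meanDev B fun j => (h ^ 2) (z j)) '' H) := fun B => by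
    rw [sSup_image']
    congr 1
    ext i
    congr 1
    ext j
    exact hv2 i j
  have key := orbitAvg_iSup_meanDev_tail_le hvM (i₀ := ⟨0, h₀⟩) (by simp [hv]) (S := S)
    (by omega) (by simpa [hS] using hkn) (r := r) (K := K) (y := y) (ψ := ψ)
    (fun i => by
      have := hT i.1 i.2
      simp only [hv2]
      simpa [avgSq, fullAvg] using this) hM hK hy
    (by
      rw [← hA.integral _ S hS]
      simp only [e1]
      exact h1)
    (fun h => by
      rw [← hA.integral _ S hS]
      simp only [e2]
      exact h2 (by simpa [hS] using h))
  rw [← hA.integral _ S hS, hS] at key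
  refine le_trans ?_ key
  set G : Set (Draw m u) := {d | 48 * ψ + r / K + 2176 * K * M ^ 2 * y / k <
    ⨆ i, meanDev (A d) (v i)} with hG
  have hGint : ∫ d, (if 48 * ψ + r / K + 2176 * K * M ^ 2 * y / k <
      ⨆ i, meanDev (A d) (v i) then (1 : ℝ) else 0) ∂(drawLaw m u) = (drawLaw m u).real G := by
    rw [← integral_indicator_one (Set.toFinite G).measurableSet]
    congr 1
  rw [hGint]
  refine measureReal_mono (fun d hd => ?_) (measure_ne_top _ _)
  simp only [Set.mem_ofPred_eq, not_forall, not_le] at hd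
  obtain ⟨h, hh, hlt⟩ := hd
  refine hlt.trans_le ?_
  have hb : BddAbove (Set.range fun i => meanDev (A d) (v i)) := by
    obtain ⟨C, hC⟩ := bddAbove_dev (p := (#S : ℝ) / Fintype.card (Fin (m + u))) hvM (A d)
    refine ⟨C / k, ?_⟩
    rintro _ ⟨i, rfl⟩
    have h3 := hC ⟨i, rfl⟩
    simp only at h3
    rw [sum_sub_eq_card_mul_meanDev (by rw [hA.card, hS]) (by omega), hS] at h3
    rw [le_div_iff₀ (by exact_mod_cast hk)]
    simp only
    linarith
  have h4 := le_ciSup hb ⟨h, hh⟩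
  simpa only [hv, meanDev_const_mul] using h4

/-- The tail bound in terms of the fixed point of a sub-root function. -/
theorem IsUniformSet.measureReal_tail_le_of_isSubRoot (hA : IsUniformSet A k) (hk : 1 ≤ k)
    (hkn : k < m + u) (h₀ : 0 ∈ H) (hM : 1 ≤ M) (hH : ∀ h ∈ H, ∀ i, |h (z i)| ≤ M)
    (hT : ∀ h ∈ H, avgSq z h ≤ r) (hK : 1 ≤ K) (hy : 1 / 2 ≤ y) {s q t : ℝ} {ψ : ℝ → ℝ}
    (hψ : IsSubRoot ψ) (hq : IsFixedPointOf ψ q) (hqt : q < t) (htr : t ≤ r) (hs : s ^ 2 = 1)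
    (h1 : expSup H (fun d h => s * meanDev (A d) fun j => h (z j)) ≤ ψ r)
    (h2 : 2 * k < m + u → expSup H (fun d h => meanDev (A d) fun j => (h ^ 2) (z j)) ≤ ψ r) :
    (drawLaw m u).real {d | ¬ ∀ h ∈ H, s * meanDev (A d) (fun j => h (z j)) ≤
      2 * r / K + 576 * K * t + 2176 * K * M ^ 2 * y / k} ≤ Real.exp (-y) := by
  refine le_trans (measureReal_mono (fun d hd => ?_) (measure_ne_top _ _))
    (hA.measureReal_tail_le hk hkn h₀ hM hH hT hK hy hs h1 h2)
  rw [Set.mem_ofPred_eq] at hd ⊢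
  contrapose! hd
  intro h hh
  refine (hd h hh).trans ?_
  have := hψ.const_mul_le hq hqt htr hK
  have e : 2 * r / K = r / K + r / K := by ring
  linarith

end Tail

/-! ### The localized classes -/

section Classes

variable {X Y : Type*} {m u : ℕ} {z : Fin (m + u) → X × Y} {ℓ : ℝ → Y → ℝ} {F : Set (X → ℝ)}
  {fstar : X → ℝ} {B L₀ r : ℝ}

lemma abs_lossOf_sub_le
    (hℓ : ∀ f ∈ F, ∀ i, 0 ≤ lossOf ℓ f (z i) ∧ lossOf ℓ f (z i) ≤ L₀) {f g : X → ℝ}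
    (hf : f ∈ F) (hg : g ∈ F) (i : Fin (m + u)) :
    |(lossOf ℓ f - lossOf ℓ g) (z i)| ≤ L₀ := by
  have h1 := hℓ f hf i
  have h2 := hℓ g hg i
  rw [Pi.sub_apply, abs_le]
  constructor <;> linarith

lemma avgSq_sub_le (hmain : MainAssumption z ℓ F fstar B) {f g : X → ℝ} (hf : f ∈ F)
    (hg : g ∈ F) : avgSq z (lossOf ℓ f - lossOf ℓ g) ≤
      2 * B * fullAvg z (lossOf ℓ f - lossOf ℓ fstar) +
        2 * B * fullAvg z (lossOf ℓ g - lossOf ℓ fstar) := by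
  have h1 := hmain.avgSq_le _ ⟨f, hf, rfl⟩
  have h2 := hmain.avgSq_le _ ⟨g, hg, rfl⟩
  have h3 : avgSq z (lossOf ℓ f - lossOf ℓ g) ≤
      2 * avgSq z (lossOf ℓ f - lossOf ℓ fstar) + 2 * avgSq z (lossOf ℓ g - lossOf ℓ fstar) := by
    unfold avgSq fullAvg
    rw [mul_div_assoc', mul_div_assoc', ← add_div, mul_sum, mul_sum, ← sum_add_distrib]
    refine div_le_div_of_nonneg_right (sum_le_sum fun i _ => ?_) (by positivity)
    simp only [Pi.pow_apply, Pi.sub_apply]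
    nlinarith [sq_nonneg (lossOf ℓ f (z i) - lossOf ℓ fstar (z i) +
      (lossOf ℓ g (z i) - lossOf ℓ fstar (z i)))]
  linarith

/-- Every representation of `h` gives a value at least `T_n(h)`. Without a lower bound the real
`sInf` would be the default `0` and carry no information. -/
lemma bddBelow_surrogate (hmain : MainAssumption z ℓ F fstar B) (h : X × Y → ℝ) :
    BddBelow {t | ∃ f₁ ∈ F, ∃ f₂ ∈ F, lossOf ℓ f₁ - lossOf ℓ f₂ = h ∧
      t = 2 * B * fullAvg z (lossOf ℓ f₁ - lossOf ℓ fstar) +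
        2 * B * fullAvg z (lossOf ℓ f₂ - lossOf ℓ fstar)} := by
  refine ⟨avgSq z h, ?_⟩
  rintro t ⟨f₁, h₁, f₂, h₂, rfl, rfl⟩
  exact avgSq_sub_le hmain h₁ h₂

lemma avgSq_le_of_mem_localDiff (hmain : MainAssumption z ℓ F fstar B) {h : X × Y → ℝ}
    (hh : h ∈ localDiff z ℓ F fstar B r) : avgSq z h ≤ r := by
  obtain ⟨⟨f₁, h₁, f₂, h₂, rfl⟩, hs⟩ := hh
  refine le_trans ?_ hs
  unfold surrogate
  refine le_csInf ⟨_, f₁, h₁, f₂, h₂, rfl, rfl⟩ ?_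
  rintro t ⟨g₁, k₁, g₂, k₂, hg, rfl⟩
  rw [← hg]
  exact avgSq_sub_le hmain k₁ k₂

lemma sub_mem_localDiff (hmain : MainAssumption z ℓ F fstar B) {f g : X → ℝ} (hf : f ∈ F)
    (hg : g ∈ F) (hr : 2 * B * fullAvg z (lossOf ℓ f - lossOf ℓ fstar) +
        2 * B * fullAvg z (lossOf ℓ g - lossOf ℓ fstar) ≤ r) :
    lossOf ℓ f - lossOf ℓ g ∈ localDiff z ℓ F fstar B r :=
  ⟨⟨f, hf, g, hg, rfl⟩,
    (csInf_le (bddBelow_surrogate hmain _) ⟨f, hf, g, hg, rfl, rfl⟩).trans hr⟩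

lemma zero_mem_localDiff (hmain : MainAssumption z ℓ F fstar B) (hr : 0 ≤ r) :
    0 ∈ localDiff z ℓ F fstar B r := by
  have h := sub_mem_localDiff (r := r) hmain hmain.mem hmain.mem (by simpa [fullAvg] using hr)
  simpa using h

lemma zero_mem_localStar (hmain : MainAssumption z ℓ F fstar B) (hr : 0 ≤ r) :
    0 ∈ localStar z ℓ F fstar B r :=
  ⟨⟨fstar, hmain.mem, by simp⟩, by simpa [fullAvg] using hr⟩

/-- The peeling argument: the full-sample excess losses that are dominated by their deviations are
small. -/
theorem IsUniformSet.measureReal_peeling_le {A : Draw m u → Finset (Fin (m + u))} {k : ℕ}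
    (hA : IsUniformSet A k) (hk : 1 ≤ k) (hkn : k < m + u) (hL₀ : 1 ≤ L₀)
    (hℓ : ∀ f ∈ F, ∀ i, 0 ≤ lossOf ℓ f (z i) ∧ lossOf ℓ f (z i) ≤ L₀) (hB : 0 ≤ B)
    (hmain : MainAssumption z ℓ F fstar B) {ψ : ℝ → ℝ} {q : ℝ} (hψ : IsSubRoot ψ)
    (hq : IsFixedPointOf ψ q)
    (h1 : ∀ r, q ≤ r → expSup (localStar z ℓ F fstar B r)
      (fun d h => -1 * meanDev (A d) fun j => h (z j)) ≤ ψ r)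
    (h2 : ∀ r, q ≤ r → 2 * k < m + u → expSup (localStar z ℓ F fstar B r)
      (fun d h => meanDev (A d) fun j => (h ^ 2) (z j)) ≤ ψ r)
    {x N : ℝ} (hx : Real.log 2 ≤ x) (hN : 0 < N) (hNk : N ≤ k) :
    (drawLaw m u).real {d | ¬ ∀ f ∈ F, fullAvg z (lossOf ℓ f - lossOf ℓ fstar) ≤
        -1 * meanDev (A d) (fun j => (lossOf ℓ f - lossOf ℓ fstar) (z j)) →
      B * fullAvg z (lossOf ℓ f - lossOf ℓ fstar) ≤
        (1 + 29568 * B * (1 + 24 * B) * L₀ ^ 2) * (q + x / N)} ≤ Real.exp (-x) / 2 := by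
  have hlog : 1 / 2 < Real.log 2 := by have := Real.log_two_gt_d9; linarith
  have hx0 : 0 < x := by linarith
  have hq0 : 0 ≤ q := hq.1.1
  have hL2 : 1 ≤ L₀ ^ 2 := by nlinarith
  set C : ℝ := 1 + 29568 * B * (1 + 24 * B) * L₀ ^ 2 with hC
  have hC1 : 1 ≤ C := by
    have : 0 ≤ 29568 * B * (1 + 24 * B) * L₀ ^ 2 := by positivity
    linarith
  set t : ℝ := q + x / N with ht
  have hxN : 0 < x / N := by positivity
  have htpos : 0 < t := by linarith
  have hqt : q < t := by linarith
  set ρ : ℕ → ℝ := fun j => 4 ^ j * (C * t) with hρ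
  have hCt : 0 < C * t := by positivity
  have htρ : ∀ j, t ≤ ρ j := fun j => by
    have h4 : (1 : ℝ) ≤ 4 ^ j := one_le_pow₀ (by norm_num)
    have : t ≤ C * t := le_mul_of_one_le_left htpos.le hC1
    exact this.trans (le_mul_of_one_le_left hCt.le h4)
  -- The outermost shell contains the whole class, since excess losses are at most `L₀`; finitely
  -- many shells suffice.
  obtain ⟨J, hJ⟩ : ∃ J : ℕ, B * L₀ ≤ ρ J := by
    obtain ⟨J, hJ⟩ := pow_unbounded_of_one_lt (B * L₀ / (C * t)) (by norm_num : (1 : ℝ) < 4)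
    exact ⟨J, ((div_lt_iff₀ hCt).1 hJ).le⟩
  -- Shell `j` fails with probability at most `e^{-x} 2^{-(j+2)}`; these sum to at most `e^{-x}/2`.
  set y : ℕ → ℝ := fun j => x + (j + 2 : ℕ) * Real.log 2 with hy
  -- Chosen so that `B · 2ρ_{j+1}/K = 8Bρ_j/(1 + 24B) ≤ ρ_j/3`. The other terms total at most `17984
  -- B K L₀² 4^j t`, where `17984 = 576 + 8 · 2176`, and the constant in `C` makes this at most
  -- `2ρ_j/3`.
  set K : ℝ := 1 + 24 * B with hK
  have hK1 : 1 ≤ K := by linarith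
  set bad : ℕ → Set (Draw m u) := fun j => {d | ¬ ∀ h ∈ localStar z ℓ F fstar B (ρ (j + 1)),
    -1 * meanDev (A d) (fun j => h (z j)) ≤
      2 * ρ (j + 1) / K + 576 * K * t + 2176 * K * L₀ ^ 2 * y j / k} with hbad
  have hbadle : ∀ j, (drawLaw m u).real (bad j) ≤ Real.exp (-x) / 4 * (1 / 2) ^ j := by
    intro j
    have hyj : Real.exp (-y j) = Real.exp (-x) / 4 * (1 / 2) ^ j := by
      have e : -y j = -x + (j + 2 : ℕ) * Real.log (1 / 2) := by
        rw [hy, one_div, Real.log_inv]; ring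
      rw [e, Real.exp_add, Real.exp_nat_mul, Real.exp_log (by norm_num), pow_add]
      ring
    rw [← hyj]
    refine hA.measureReal_tail_le_of_isSubRoot hk hkn
      (zero_mem_localStar hmain (htpos.le.trans (htρ _))) hL₀ ?_ ?_ hK1 ?_ hψ hq hqt (htρ _)
      (by norm_num) (h1 _ (hqt.le.trans (htρ _))) (h2 _ (hqt.le.trans (htρ _)))
    · rintro h ⟨⟨f, hf, rfl⟩, -⟩ i
      exact abs_lossOf_sub_le hℓ hf hmain.mem i
    · rintro h ⟨hh, hr⟩
      exact (hmain.avgSq_le h hh).trans hr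
    · have : (0 : ℝ) ≤ (j + 2 : ℕ) * Real.log 2 := by positivity
      simp only [hy]
      linarith
  have hstep : ∀ j, B * (2 * ρ (j + 1) / K + 576 * K * t + 2176 * K * L₀ ^ 2 * y j / k) ≤
      ρ j := by
    intro j
    have h4 : (1 : ℝ) ≤ 4 ^ j := one_le_pow₀ (by norm_num)
    have hρj : ρ (j + 1) = 4 * ρ j := by simp only [hρ]; ring
    have hyj : y j ≤ 8 * 4 ^ j * x := by
      have e1 : ((j + 2 : ℕ) : ℝ) + 1 ≤ 8 * 4 ^ j := by
        clear_value C t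
        induction j with
        | zero => norm_num
        | succ j ih =>
          have := ih (by exact one_le_pow₀ (by norm_num)) (by simp only [hρ]; ring)
          rw [pow_succ]
          push_cast at *
          have : (0 : ℝ) ≤ j := by positivity
          linarith
      have e2 : ((j + 2 : ℕ) : ℝ) * Real.log 2 ≤ (j + 2 : ℕ) * x := by gcongr
      have e3 := mul_le_mul_of_nonneg_right e1 hx0.le
      simp only [hy]
      linarith
    have hyk : y j / k ≤ 8 * 4 ^ j * t := by
      have hk0 : (0 : ℝ) < k := hN.trans_le hNk
      calc y j / k ≤ 8 * 4 ^ j * x / k := by gcongr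
        _ ≤ 8 * 4 ^ j * x / N := by gcongr
        _ = 8 * 4 ^ j * (x / N) := by ring
        _ ≤ 8 * 4 ^ j * t := by gcongr; linarith
    have hBK : B * (2 * ρ (j + 1) / K) ≤ ρ j / 3 := by
      have hρ0 : 0 ≤ ρ j := htpos.le.trans (htρ j)
      rw [hρj, mul_div_assoc', div_le_div_iff₀ (by linarith) (by norm_num)]
      rw [hK]
      nlinarith [mul_nonneg hB hρ0]
    have e1 : 576 * K * t ≤ 576 * K * L₀ ^ 2 * 4 ^ j * t := by
      have h5 : 1 ≤ L₀ ^ 2 * 4 ^ j := by nlinarith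
      have := mul_le_mul_of_nonneg_left h5 (by positivity : 0 ≤ 576 * K * t)
      linarith
    have e2 : 2176 * K * L₀ ^ 2 * y j / k ≤ 17408 * K * L₀ ^ 2 * 4 ^ j * t := by
      have := mul_le_mul_of_nonneg_left hyk (by positivity : 0 ≤ 2176 * K * L₀ ^ 2)
      refine le_trans (le_of_eq ?_) (this.trans_eq ?_) <;> ring
    have e3 : B * (17984 * K * L₀ ^ 2 * 4 ^ j * t) ≤ 2 / 3 * ρ j := by
      simp only [hρ, hC]
      have : 0 ≤ 4 ^ j * t := by positivity
      have e4 : 0 ≤ B * K * L₀ ^ 2 * (4 ^ j * t) := by positivity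
      nlinarith
    have e5 := mul_le_mul_of_nonneg_left (add_le_add e1 e2) hB
    linarith
  calc _ ≤ (drawLaw m u).real (⋃ j ∈ range J, bad j) := by
        refine measureReal_mono (fun d hd => ?_) (measure_ne_top _ _)
        by_contra hgood
        refine hd fun f hf hle => ?_
        simp only [Set.mem_iUnion, not_exists, hbad, Set.mem_ofPred_eq, not_not, mem_range] at hgood
        -- Descent: on the good event, membership in shell `j + 1` bounds the deviation, which
        -- dominates the excess loss, and so forces it into shell `j`.
        have hdesc : ∀ j ≤ J, B * fullAvg z (lossOf ℓ f - lossOf ℓ fstar) ≤ ρ j →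
            B * fullAvg z (lossOf ℓ f - lossOf ℓ fstar) ≤ C * t := by
          intro j
          induction j with
          | zero => intro _ h; simpa [hρ] using h
          | succ j ih =>
            intro hj h
            refine ih (by omega) (le_trans ?_ (hstep j))
            exact mul_le_mul_of_nonneg_left
              (hle.trans (hgood j (by omega) _ ⟨⟨f, hf, rfl⟩, h⟩)) hB
        refine hdesc J le_rfl (le_trans (mul_le_mul_of_nonneg_left ?_ hB) hJ)
        unfold fullAvg
        have hn : (0 : ℝ) < (m : ℝ) + u := by exact_mod_cast (by omega : 0 < m + u)
        rw [div_le_iff₀ hn]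
        refine (sum_le_sum fun i _ => (le_abs_self _).trans
          (abs_lossOf_sub_le hℓ hf hmain.mem i)).trans_eq ?_
        simp [mul_comm]
    _ ≤ ∑ j ∈ range J, (drawLaw m u).real (bad j) := measureReal_biUnion_finset_le _ _
    _ ≤ ∑ j ∈ range J, Real.exp (-x) / 4 * (1 / 2) ^ j := sum_le_sum fun j _ => hbadle j
    _ ≤ _ := by
        rw [← mul_sum]
        have := sum_geometric_two_le J
        have e := Real.exp_pos (-x)
        nlinarith

end Classes

/-! ### The excess risk bound -/

section ExcessRisk

variable {X Y : Type*} {m u : ℕ} {z : Fin (m + u) → X × Y} {ℓ : ℝ → Y → ℝ} {F : Set (X → ℝ)}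
  {fstar : X → ℝ}

lemma testAvg_sub (d : Draw m u) (g h : X × Y → ℝ) :
    testAvg z d (g - h) = testAvg z d g - testAvg z d h := by
  simp [testAvg, sum_sub_distrib, sub_div]

lemma trainAvg_sub (d : Draw m u) (g h : X × Y → ℝ) :
    trainAvg z d (g - h) = trainAvg z d g - trainAvg z d h := by
  simp [trainAvg, sum_sub_distrib, sub_div]

/-- If the mean squares of the excess losses vanish, all predictors have the same losses. -/
lemma excessRisk_eq_zero (hm : 1 ≤ m) (hmain : MainAssumption z ℓ F fstar 0)
    {fhatm fhatu : Draw m u → X → ℝ} (hm' : IsTrainMinimizer z ℓ F fhatm)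
    (hu' : IsTestMinimizer z ℓ F fhatu) (d : Draw m u) : excessRisk z ℓ fhatm fhatu d = 0 := by
  have hn : (0 : ℝ) < (m : ℝ) + u := by exact_mod_cast (by omega : 0 < m + u)
  have h : ∀ f ∈ F, ∀ i, lossOf ℓ f (z i) = lossOf ℓ fstar (z i) := by
    intro f hf i
    have h1 := hmain.avgSq_le _ ⟨f, hf, rfl⟩
    rw [zero_mul, avgSq, fullAvg, div_le_iff₀ hn, zero_mul] at h1
    have h2 := (sum_eq_zero_iff_of_nonneg fun i _ => by
      simp only [Pi.pow_apply]; positivity).1 (le_antisymm h1 (sum_nonneg fun i _ => by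
      simp only [Pi.pow_apply]; positivity)) i (mem_univ i)
    simpa [sub_eq_zero] using h2
  unfold excessRisk testAvg
  rw [sum_congr rfl fun i _ => h _ (hm' d).1 i, sum_congr rfl fun i _ => h _ (hu' d).1 i, sub_self]

end ExcessRisk

end

end Transductive

open Transductive in
theorem mainTheorem1 :
    ∃ (c₀ : ℝ → ℝ) (c₁ c₂ : ℝ → ℝ → ℝ),
      (∀ K, 1 < K → 0 < c₀ K) ∧
      (∀ K L₀, 1 < K → 2 * Real.sqrt 2 ≤ L₀ → 0 < c₁ K L₀) ∧
      (∀ B L₀, 0 ≤ B → 2 * Real.sqrt 2 ≤ L₀ → 0 < c₂ B L₀) ∧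
      ∀ {X Y : Type*} (m u : ℕ) (_hm : 1 ≤ m) (_hu : 1 ≤ u)
        (z : Fin (m + u) → X × Y) (ℓ : ℝ → Y → ℝ) (F : Set (X → ℝ))
        (L₀ : ℝ) (_hL₀ : 2 * Real.sqrt 2 ≤ L₀)
        (_hℓ : ∀ f ∈ F, ∀ i, 0 ≤ Transductive.lossOf ℓ f (z i) ∧
          Transductive.lossOf ℓ f (z i) ≤ L₀)
        (fstar : X → ℝ) (B : ℝ) (_hB : 0 ≤ B)
        (_hmain : Transductive.MainAssumption z ℓ F fstar B)
        (fhatm fhatu : Transductive.Draw m u → X → ℝ)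
        (_hfhatm : Transductive.IsTrainMinimizer z ℓ F fhatm)
        (_hfhatu : Transductive.IsTestMinimizer z ℓ F fhatu)
        (ψu ψm ψum : ℝ → ℝ) (ru rm rstar : ℝ)
        (_hψu : Transductive.IsSubRoot ψu) (_hru : Transductive.IsFixedPointOf ψu ru)
        (_hψm : Transductive.IsSubRoot ψm) (_hrm : Transductive.IsFixedPointOf ψm rm)
        (_hψum : Transductive.IsSubRoot ψum) (_hrstar : Transductive.IsFixedPointOf ψum rstar)
        (_hcu : ∀ r, ru ≤ r →
          max (Transductive.expSup (Transductive.localDiff z ℓ F fstar B r)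
                (fun d h => Transductive.testDev z d h))
              (Transductive.expSup (Transductive.localDiff z ℓ F fstar B r)
                (fun d h => Transductive.testDev z d (h ^ 2))) ≤ ψu r)
        (_hcm : ∀ r, rm ≤ r →
          max (Transductive.expSup (Transductive.localDiff z ℓ F fstar B r)
                (fun d h => -Transductive.trainDev z d h))
              (Transductive.expSup (Transductive.localDiff z ℓ F fstar B r)
                (fun d h => Transductive.trainDev z d (h ^ 2))) ≤ ψm r)
        (_hcum : ∀ r, rstar ≤ r →
          max (max (Transductive.expSup (Transductive.localStar z ℓ F fstar B r)
                    (fun d h => -Transductive.testDev z d h))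
                  (Transductive.expSup (Transductive.localStar z ℓ F fstar B r)
                    (fun d h => -Transductive.trainDev z d h)))
              (Transductive.expSup (Transductive.localStar z ℓ F fstar B r)
                (fun d h => Transductive.minDev z d (h ^ 2))) ≤ ψum r)
        (K : ℝ) (_hK : 1 < K) (x : ℝ) (_hx : 0 < x),
        1 - 2 * Real.exp (-x) ≤
          (Transductive.drawLaw m u).real
            {d | Transductive.excessRisk z ℓ fhatm fhatu d ≤
              c₀ K * (ru + rm) + 4 * B * c₂ B L₀ * rstar / K +
                (c₁ K L₀ + 4 * B * c₂ B L₀ / K) * x / (min m u : ℕ)} := by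
  -- The third constant makes `4 B c₂ = 16 C` for `B > 0`, with `C` the peeling constant. At `B = 0`
  -- any positive value serves, as the excess risk then vanishes.
  refine ⟨fun K => 576 * K + 4, fun K L₀ => 1152 * K + 8704 * K * L₀ ^ 2 + 4,
    fun B L₀ => if B = 0 then 1 else 4 * (1 + 29568 * B * (1 + 24 * B) * L₀ ^ 2) / B,
    fun K hK => by positivity, fun K L₀ hK _ => by positivity, fun B L₀ hB _ => ?_, ?_⟩
  · dsimp only
    split_ifs with h
    · exact one_pos
    · have : 0 < B := lt_of_le_of_ne hB (Ne.symm h)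
      positivity
  intro X Y m u hm hu z ℓ F L₀ hL₀ hℓ fstar B hB hmain fhatm fhatu hfm hfu ψu ψm ψum ru rm rstar
    hψu hru hψm hrm hψum hrstar hcu hcm hcum K hK x hx
  have hK0 : 0 < K := by linarith
  have hL1 : 1 ≤ L₀ := by
    have : 1 ≤ Real.sqrt 2 := Real.one_le_sqrt.2 (by norm_num)
    linarith
  have hru0 : 0 ≤ ru := hru.1.1
  have hrm0 : 0 ≤ rm := hrm.1.1
  have hrs0 : 0 ≤ rstar := hrstar.1.1
  set N : ℝ := ((min m u : ℕ) : ℝ) with hN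
  have hN0 : 0 < N := by
    have : 0 < min m u := by omega
    rw [hN]; positivity
  have hNm : N ≤ m := by rw [hN]; exact_mod_cast min_le_left m u
  have hNu : N ≤ u := by rw [hN]; exact_mod_cast min_le_right m u
  rcases hB.eq_or_lt with hB0 | hB0
  · subst hB0
    have : {d | excessRisk z ℓ fhatm fhatu d ≤ (576 * K + 4) * (ru + rm) +
        4 * 0 * (if (0 : ℝ) = 0 then 1
          else 4 * (1 + 29568 * 0 * (1 + 24 * 0) * L₀ ^ 2) / 0) * rstar / K +
        ((1152 * K + 8704 * K * L₀ ^ 2 + 4) + 4 * 0 * (if (0 : ℝ) = 0 then 1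
          else 4 * (1 + 29568 * 0 * (1 + 24 * 0) * L₀ ^ 2) / 0) / K) * x / N} = Set.univ := by
      refine Set.eq_univ_of_forall fun d => ?_
      rw [Set.mem_ofPred_eq, excessRisk_eq_zero hm hmain hfm hfu]
      have : 0 ≤ (1152 * K + 8704 * K * L₀ ^ 2 + 4) * x / N := by positivity
      have : 0 ≤ (576 * K + 4) * (ru + rm) := by positivity
      simp only [mul_zero, zero_mul, zero_div, add_zero]
      linarith
    rw [this, probReal_univ]
    have := Real.exp_pos (-x)
    linarith
  -- For `x < log 2` the claimed probability is negative.
  rcases lt_or_ge x (Real.log 2) with hx2 | hx2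
  · refine le_trans ?_ measureReal_nonneg
    have h1 : Real.exp (-Real.log 2) ≤ Real.exp (-x) := Real.exp_le_exp.2 (by linarith)
    rw [Real.exp_neg, Real.exp_log (by norm_num)] at h1
    linarith
  have hlog : 1 / 2 < Real.log 2 := by have := Real.log_two_gt_d9; linarith
  set C : ℝ := 1 + 29568 * B * (1 + 24 * B) * L₀ ^ 2 with hC
  have hC1 : 1 ≤ C := by
    have : 0 ≤ 29568 * B * (1 + 24 * B) * L₀ ^ 2 := by positivity
    linarith
  have hxN : 0 < x / N := by positivity
  set σ : ℝ := C * (rstar + x / N) with hσ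
  have hσ0 : 0 ≤ σ := by positivity
  -- `4σ` bounds the surrogate variance of the difference of the two minimizers. The remaining terms
  -- put `r` above `ru + x/N` and `rm + x/N`, which lie strictly above the fixed points, as
  -- `IsSubRoot.const_mul_le` requires.
  set r : ℝ := 4 * σ + ru + rm + x / N with hr
  have hr0 : 0 ≤ r := by positivity
  set y : ℝ := x + Real.log 2 with hy
  have hyexp : Real.exp (-y) = Real.exp (-x) / 2 := by
    rw [hy, neg_add, Real.exp_add, Real.exp_neg (Real.log 2), Real.exp_log (by norm_num)]
    ring
  have hDbd : ∀ h ∈ localDiff z ℓ F fstar B r, ∀ i, |h (z i)| ≤ L₀ := by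
    rintro h ⟨⟨f, hf, g, hg, rfl⟩, -⟩ i
    exact abs_lossOf_sub_le hℓ hf hg i
  have hDsq : ∀ h ∈ localDiff z ℓ F fstar B r, avgSq z h ≤ r := fun h hh =>
    avgSq_le_of_mem_localDiff hmain hh
  simp only [testDev_eq_meanDev, trainDev_eq_meanDev, ← neg_one_mul (meanDev _ _), max_le_iff,
    minDev] at hcu hcm hcum
  have b1 := isUniformSet_testSet.measureReal_tail_le_of_isSubRoot hu (by omega)
    (zero_mem_localDiff hmain hr0) hL1 hDbd hDsq hK.le (y := y) (by linarith) (s := 1) hψu hru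
    (t := ru + x / N) (by linarith) (by linarith) (by norm_num)
    (by simpa only [one_mul] using (hcu r (by linarith)).1) (fun _ => (hcu r (by linarith)).2)
  have b2 := isUniformSet_trainSet.measureReal_tail_le_of_isSubRoot hm (by omega)
    (zero_mem_localDiff hmain hr0) hL1 hDbd hDsq hK.le (y := y) (by linarith) (s := -1) hψm hrm
    (t := rm + x / N) (by linarith) (by linarith) (by norm_num)
    (hcm r (by linarith)).1 (fun _ => (hcm r (by linarith)).2)
  have b3 := isUniformSet_testSet.measureReal_peeling_le hu (by omega) hL1 hℓ hB hmain hψum hrstar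
    (fun r hr => (hcum r hr).1.1) (fun r hr h => by
      simpa only [if_pos (by omega : u ≤ m)] using (hcum r hr).2) hx2 hN0 hNu
  have b4 := isUniformSet_trainSet.measureReal_peeling_le hm (by omega) hL1 hℓ hB hmain hψum hrstar
    (fun r hr => (hcum r hr).1.2) (fun r hr h => by
      simpa only [if_neg (by omega : ¬ u ≤ m)] using (hcum r hr).2) hx2 hN0 hNm
  rw [hyexp] at b1 b2
  rw [← hC, ← hσ] at b3 b4
  set E₁ := {d : Draw m u | ¬ ∀ h ∈ localDiff z ℓ F fstar B r,
    1 * meanDev (testSet d) (fun j => h (z j)) ≤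
      2 * r / K + 576 * K * (ru + x / N) + 2176 * K * L₀ ^ 2 * y / u}
  set E₂ := {d : Draw m u | ¬ ∀ h ∈ localDiff z ℓ F fstar B r,
    -1 * meanDev (trainSet d) (fun j => h (z j)) ≤
      2 * r / K + 576 * K * (rm + x / N) + 2176 * K * L₀ ^ 2 * y / m}
  set E₃ := {d : Draw m u | ¬ ∀ f ∈ F, fullAvg z (lossOf ℓ f - lossOf ℓ fstar) ≤
        -1 * meanDev (testSet d) (fun j => (lossOf ℓ f - lossOf ℓ fstar) (z j)) →
      B * fullAvg z (lossOf ℓ f - lossOf ℓ fstar) ≤ σ}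
  set E₄ := {d : Draw m u | ¬ ∀ f ∈ F, fullAvg z (lossOf ℓ f - lossOf ℓ fstar) ≤
        -1 * meanDev (trainSet d) (fun j => (lossOf ℓ f - lossOf ℓ fstar) (z j)) →
      B * fullAvg z (lossOf ℓ f - lossOf ℓ fstar) ≤ σ}
  set G := {d : Draw m u | excessRisk z ℓ fhatm fhatu d ≤ (576 * K + 4) * (ru + rm) +
    4 * B * (if B = 0 then 1 else 4 * C / B) * rstar / K +
      (1152 * K + 8704 * K * L₀ ^ 2 + 4 + 4 * B * (if B = 0 then 1 else 4 * C / B) / K) * x / N}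
    with hG
  have hcover : (Set.univ : Set (Draw m u)) ⊆ G ∪ ((E₁ ∪ E₂) ∪ (E₃ ∪ E₄)) := by
    intro d _
    by_cases hd : d ∈ (E₁ ∪ E₂) ∪ (E₃ ∪ E₄)
    · exact Or.inr hd
    refine Or.inl ?_
    simp only [Set.mem_union, not_or] at hd
    obtain ⟨⟨hd1, hd2⟩, hd3, hd4⟩ := hd
    have g1 := not_not.1 hd1
    have g2 := not_not.1 hd2
    have g3 := not_not.1 hd3
    have g4 := not_not.1 hd4
    clear hd1 hd2 hd3 hd4
    simp only [← testDev_eq_meanDev, ← trainDev_eq_meanDev, one_mul, neg_one_mul] at g1 g2 g3 g4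
    have hsm : B * fullAvg z (lossOf ℓ (fhatm d) - lossOf ℓ fstar) ≤ σ := by
      refine g4 _ (hfm d).1 ?_
      have := (hfm d).2 fstar hmain.mem
      rw [trainDev, trainAvg_sub]
      linarith
    have hsu : B * fullAvg z (lossOf ℓ (fhatu d) - lossOf ℓ fstar) ≤ σ := by
      refine g3 _ (hfu d).1 ?_
      have := (hfu d).2 fstar hmain.mem
      rw [testDev, testAvg_sub]
      linarith
    have hmem : lossOf ℓ (fhatm d) - lossOf ℓ (fhatu d) ∈ localDiff z ℓ F fstar B r :=
      sub_mem_localDiff hmain (hfm d).1 (hfu d).1 (by linarith)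
    have k1 := g1 _ hmem
    have k2 := g2 _ hmem
    have k3 := (hfm d).2 (fhatu d) (hfu d).1
    rw [testDev, testAvg_sub] at k1
    rw [trainDev, trainAvg_sub] at k2
    have hyx : y ≤ 2 * x := by linarith
    have hy0 : 0 ≤ y := by linarith
    have hu0 : (0 : ℝ) < u := hN0.trans_le hNu
    have hm0 : (0 : ℝ) < m := hN0.trans_le hNm
    have k4 : ∀ k : ℝ, N ≤ k → 2176 * K * L₀ ^ 2 * y / k ≤ 4352 * K * L₀ ^ 2 * (x / N) := by
      intro k hk
      calc 2176 * K * L₀ ^ 2 * y / k ≤ 2176 * K * L₀ ^ 2 * (2 * x) / N := by gcongr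
        _ = _ := by ring
    have k5 := k4 u hNu
    have k6 := k4 m hNm
    -- Only the `σ` term keeps its factor `1/K`; for the others `K > 1` is used to drop it, which
    -- yields the summands `4` in the first two constants.
    have k7 : 2 * r / K + 2 * r / K ≤ 16 * σ / K + 4 * (ru + rm) + 4 * (x / N) := by
      have : 2 * r / K + 2 * r / K = 16 * σ / K + 4 * (ru + rm + x / N) / K := by
        rw [hr]; ring
      rw [this]
      have : 4 * (ru + rm + x / N) / K ≤ 4 * (ru + rm + x / N) :=
        div_le_self (by positivity) hK.le
      linarith
    rw [hG, Set.mem_ofPred_eq, excessRisk, if_neg hB0.ne']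
    have e1 : 4 * B * (4 * C / B) = 16 * C := by field_simp; norm_num
    have e2 : 16 * σ / K = 16 * C * rstar / K + 16 * C / K * x / N := by rw [hσ]; ring
    have e3 : (1152 * K + 8704 * K * L₀ ^ 2 + 4 + 16 * C / K) * x / N =
      1152 * K * (x / N) + 8704 * K * L₀ ^ 2 * (x / N) + 4 * (x / N) + 16 * C / K * x / N := by
      ring
    rw [e1, e3]
    linarith
  have hle := (measureReal_mono (μ := drawLaw m u) hcover (measure_ne_top _ _)).trans
    ((measureReal_union_le _ _).trans (add_le_add_right ((measureReal_union_le _ _).trans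
      (add_le_add (measureReal_union_le E₁ E₂) (measureReal_union_le E₃ E₄))) _))
  rw [probReal_univ] at hle
  linarith
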